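/- **Setup.** Let $n,d\ge 0$, $m=(d+2)n$ and $\lambda\in[0,1]$. Identify $\{0,1\}^n$ with the lexicographically first $2^n$ strings of $\{0,1\}^m$. For $f:\{0,1\}^n\to\{0,1\}^n$ and permutations $f_0,\dots,f_{d-1}$ of $\{0,1\}^m$ let $f_d:\{0,1\}^m\to\{0,1\}^m$ be given by $f_d(f_{d-1}\circ\cdots\circ f_0(x))=f(x)$ for $x\in\{0,1\}^n$, and $f_d=0$ elsewhere. Let $\mathcal F$ be the unitary $\bigotimes_{i=0}^d|x_i\rangle|y_i\rangle\mapsto\bigotimes_{i=0}^d|x_i\rangle|y_i\oplus f_i(x_i)\rangle$. The shuffling oracle $O_{f,d}$ applies $\mathcal F$ for uniformly random $f_0,\dots,f_{d-1}$. In the *$d$-shuffling Simon's problem*, $f$ is with probability $1/2$ a uniformly random 2-to-1 function and otherwise a uniformly random 1-to-1 function; given classical query access to $f$ and quantum access to $O_{f,d}$, decide which is the case. A *$\lambda$-noisy circuit* starts in $|0^k\rangle$ for some $k$ and applies a sequence of layers, each of which is a tensor product of unitaries on at most two qubits or an application of the quantum oracle to some of the qubits. The single-qubit depolarizing channel $\rho\mapsto(1-\lambda)\rho+\lambda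 I/2$ acts on every qubit after the initialization and after each layer, and finally all qubits are measured in the computational basis. A *$\mathsf{NISQ}_\lambda$ algorithm* is a randomized adaptive decision procedure (for fixed $n,d,\lambda$) that can query $f$ classically and run $\lambda$-noisy circuits. It makes at most $N$ queries if along every computation path the number of classical queries to $f$ plus the number of uses of the quantum oracle in all circuits is at most $N$. **Theorem.** Any $\mathsf{NISQ}_\lambda$ algorithm that solves the $d$-shuffling Simon's problem with constant advantage must make $\exp(\Omega(n\cdot\min(1/2,\lambda d)))$ queries. Precisely: there is an absolute constant $c>0$ such that for every $\varepsilon>0$ there is $K_\varepsilon>0$ with the following property. For all $n,d$, all $\lambda\in[0,1]$ and all $N$, every $\mathsf{NISQ}_\lambda$ algorithm that makes at most $N$ queries and solves the $d$-shuffling Simon's problem with probability at least $\frac12+\varepsilon$ (over $f$, the shuffling, and the algorithm) satisfies $$N\ \ge\ K_\varepsilon\cdot\exp\bigl(c\,n\min(\tfrac12,\lambda d)\bigr).$$ This holds under either convention for the shuffling ($f_0,\dots,f_{d-1}$ sampled once and used for all queries, or sampled afresh at each use of the oracle, so that each use is the channel $\rho\mapsto\mathbb E_{\mathcal F}[\mathcal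 F\rho\mathcal F^\dagger]$), and under either convention for 2-to-1 functions (all functions that attain each of their values exactly twice, or only those with a hidden mask $s\ne0$, $f(x)=f(y)\iff y\in\{x,x\oplus s\}$). -/

import Mathlib

open scoped BigOperators

namespace NISQ

noncomputable section

/-! ### Bit strings, states, depolarizing noise, depth-one layers -/

/-- `{0,1}^n`; position `0` is the most significant bit. -/
abbrev Bits (n : ℕ) : Type := Fin n → Bool

/-- Operators on `k` qubits, in the computational basis. -/
abbrev Op (k : ℕ) : Type := Matrix (Bits k) (Bits k) ℂ

/-- The single-qubit depolarizing channel `ρ ↦ (1 - lam) ρ + lam (tr ρ) I / 2`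
(for a density matrix, `(1 - lam) ρ + lam I / 2`). -/
def depol (lam : ℝ) (ρ : Matrix Bool Bool ℂ) : Matrix Bool Bool ℂ :=
  (1 - (lam : ℂ)) • ρ + ((lam : ℂ) * ρ.trace / 2) • (1 : Matrix Bool Bool ℂ)

/-- The `k`-fold tensor power of the depolarizing channel: the linear map with
`⨂ i, |u i⟩⟨v i| ↦ ⨂ i, depol lam |u i⟩⟨v i|`. -/
def noise (lam : ℝ) {k : ℕ} (ρ : Op k) : Op k :=
  Matrix.of fun x y => ∑ u : Bits k, ∑ v : Bits k,
    ρ u v * ∏ i, depol lam (Matrix.single (u i) (v i) 1) (x i) (y i)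

/-- `U` is a tensor product of unitaries, each of which acts on at most two qubits: the qubits
are partitioned into blocks `B` of size at most two, with a unitary `V B` on every block. -/
def IsDepthOne {k : ℕ} (U : Op k) : Prop :=
  ∃ (P : Finpartition (Finset.univ : Finset (Fin k)))
    (V : (B : Finset (Fin k)) → Matrix (B → Bool) (B → Bool) ℂ),
    (∀ B ∈ P.parts, B.card ≤ 2) ∧
    (∀ B ∈ P.parts, V B ∈ Matrix.unitaryGroup (B → Bool) ℂ) ∧
    ∀ x y : Bits k, U x y = ∏ B ∈ P.parts, V B (fun i => x i) (fun i => y i)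

/-! ### The shuffling oracle -/

/-- `{0,1}^n` as the lexicographically first `2^n` strings of `{0,1}^((d+2)n)`:
prepend `(d+1)n` zeros. -/
def embed (n d : ℕ) (x : Bits n) : Bits ((d + 2) * n) := fun i =>
  if h : (d + 1) * n ≤ i.val then
    x ⟨i.val - (d + 1) * n, by
      have h1 := i.isLt
      have h2 : (d + 2) * n = (d + 1) * n + n := by ring
      omega⟩
  else false

/-- The random part of a shuffling: the one-to-one functions `f_0, …, f_{d-1}` on
`{0,1}^((d+2)n)`. -/
abbrev Shuffle (n d : ℕ) : Type := Fin d → Equiv.Perm (Bits ((d + 2) * n))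

/-- The composition `f_{d-1} ∘ ⋯ ∘ f_0`. -/
def Shuffle.chain {n d : ℕ} (σ : Shuffle n d) : Equiv.Perm (Bits ((d + 2) * n)) :=
  (List.ofFn σ).reverse.prod

/-- The last function `f_d`: it maps `f_{d-1}(⋯ f_0(x))` to `f x` for `x` among the first `2^n`
strings, and every other string to `0`. -/
def Shuffle.last {n d : ℕ} (σ : Shuffle n d) (f : Bits n → Bits n)
    (y : Bits ((d + 2) * n)) : Bits ((d + 2) * n) :=
  if h : ∃ x : Bits n, σ.chain (embed n d x) = y then embed n d (f h.choose)
  else fun _ => false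

/-- The sequence `f_0, …, f_d`. -/
def Shuffle.fn {n d : ℕ} (σ : Shuffle n d) (f : Bits n → Bits n) (i : Fin (d + 1)) :
    Bits ((d + 2) * n) → Bits ((d + 2) * n) :=
  if h : i.val < d then σ ⟨i.val, h⟩ else σ.last f

/-- The qubits of the registers `x_0, …, x_d` (left) and `y_0, …, y_d` (right) on which the
shuffling oracle acts. -/
abbrev OracleQubit (n d : ℕ) : Type :=
  (Fin (d + 1) × Fin ((d + 2) * n)) ⊕ (Fin (d + 1) × Fin ((d + 2) * n))

/-- The action of `(f_0, …, f_d)` on the basis states of `k` qubits, if its registers are placed at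
the qubits `e`: every `x_i` is kept, every `y_i` becomes `y_i ⊕ f_i(x_i)`, and the qubits
outside the registers are untouched. -/
def Shuffle.act {n d k : ℕ} (σ : Shuffle n d) (f : Bits n → Bits n)
    (e : OracleQubit n d ↪ Fin k) (z : Bits k) : Bits k := fun q =>
  xor (z q) (Function.extend e
    (Sum.elim (fun _ => false) (fun t => σ.fn f t.1 (fun j => z (e (Sum.inl (t.1, j)))) t.2))
    (fun _ => false) q)

/-- The matrix of `Shuffle.act`. -/
def Shuffle.unitary {n d k : ℕ} (σ : Shuffle n d) (f : Bits n → Bits n)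
    (e : OracleQubit n d ↪ Fin k) : Op k :=
  Matrix.of fun a b => if a = σ.act f e b then 1 else 0

/-- A quantum oracle on the registers of the shuffling oracle: a map on `k`-qubit states, for each
placement of the registers. -/
abbrev Oracle (n d : ℕ) : Type :=
  (k : ℕ) → (OracleQubit n d ↪ Fin k) → Op k → Op k

/-- The oracle that applies one fixed shuffling of `f`. -/
def fixedOracle {n d : ℕ} (σ : Shuffle n d) (f : Bits n → Bits n) : Oracle n d :=
  fun _ e ρ => σ.unitary f e * ρ * (σ.unitary f e).conjTranspose

/-- The channel `O_{f,d}`: the average of all `fixedOracle σ f`. -/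
def mixedOracle (n d : ℕ) (f : Bits n → Bits n) : Oracle n d :=
  fun k e ρ => 𝔼 σ : Shuffle n d, fixedOracle σ f k e ρ

/-! ### Algorithms -/

/-- A layer of a circuit on `k` qubits: a depth-one unitary or a use of the quantum oracle. -/
inductive Layer (n d k : ℕ) : Type
  | gates (U : Op k) (hU : IsDepthOne U)
  | query (e : OracleQubit n d ↪ Fin k)

/-- Apply a layer, without noise. -/
def Layer.apply {n d k : ℕ} (O : Oracle n d) : Layer n d k → Op k → Op k
  | .gates U _, ρ => U * ρ * U.conjTranspose
  | .query e, ρ => O k e ρ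

/-- `1` for a use of the quantum oracle, `0` for a layer of gates. -/
def Layer.cost {n d k : ℕ} : Layer n d k → ℕ
  | .gates _ _ => 0
  | .query _ => 1

/-- The final state of the noisy circuit with the given layers (first layer first): it starts in
`|0^k⟩⟨0^k|`, and the initialization and each layer are followed by depolarizing noise on all
qubits. -/
def finalState (lam : ℝ) {n d k : ℕ} (O : Oracle n d) (L : List (Layer n d k)) : Op k :=
  L.foldl (fun ρ l => noise lam (l.apply O ρ))
    (noise lam (Matrix.single (fun _ => false) (fun _ => false) 1))

/-- The probability that the noisy circuit outputs `s`. -/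
def outputProb (lam : ℝ) {n d k : ℕ} (O : Oracle n d) (L : List (Layer n d k)) (s : Bits k) : ℝ :=
  (finalState lam O L s s).re

/-- A hybrid algorithm that has classical access to `f` and can run noisy circuits with access to
a quantum oracle, as an adaptive decision tree: it outputs a bit, or samples a number from a
distribution of its choice, or queries `f` classically, or runs a circuit of any width `k` and
observes its output string; it then proceeds depending on the outcome. -/
inductive Algorithm (n d : ℕ) : Type
  | output (b : Bool)
  | toss (p : PMF ℕ) (next : ℕ → Algorithm n d)
  | classical (x : Bits n) (next : Bits n → Algorithm n d)
  | circuit (k : ℕ) (L : List (Layer n d k)) (next : Bits k → Algorithm n d)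

/-- The probability that the algorithm outputs `b`, at noise rate `lam`, with classical access to `f`
and with quantum oracle `O`. -/
def Algorithm.prob {n d : ℕ} (lam : ℝ) (f : Bits n → Bits n) (O : Oracle n d) (b : Bool) :
    Algorithm n d → ℝ
  | .output c => if c = b then 1 else 0
  | .toss p next => ∑' i, (p i).toReal * (next i).prob lam f O b
  | .classical x next => (next (f x)).prob lam f O b
  | .circuit _ L next => ∑ s, outputProb lam O L s * (next s).prob lam f O b

/-- At most `N` queries are made along every root-to-leaf path, where a classical query to `f` counts
once and each use of the quantum oracle in a circuit counts once. -/
def Algorithm.QueriesAtMost {n d : ℕ} : Algorithm n d → ℕ → Prop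
  | .output _, _ => True
  | .toss _ next, N => ∀ i, (next i).QueriesAtMost N
  | .classical _ next, N => 1 ≤ N ∧ ∀ y, (next y).QueriesAtMost (N - 1)
  | .circuit _ L next, N =>
      (L.map Layer.cost).sum ≤ N ∧ ∀ s, (next s).QueriesAtMost (N - (L.map Layer.cost).sum)

/-! ### The shuffling Simon's problem -/

/-- The two usual meanings of "two-to-one" in Simon's problem: any two-to-one function, or one
with a hidden XOR mask. -/
inductive Promise : Type
  | arbitrary
  | mask

/-- Two-to-one functions: each attained value is attained exactly twice; for `mask` there is
moreover a nonzero `s` such that `f x = f y` exactly if `y = x` or `y = x ⊕ s`. -/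
def Promise.Holds {n : ℕ} : Promise → (Bits n → Bits n) → Prop
  | .arbitrary, f => ∀ x, (Finset.univ.filter fun y => f y = f x).card = 2
  | .mask, f => ∃ s : Bits n, s ≠ (fun _ => false) ∧
      ∀ x y, f x = f y ↔ (y = x ∨ y = fun i => xor (x i) (s i))

/-- How the shuffling is sampled: once, before the algorithm starts, and the same for all uses of the
oracle; or afresh for each use, so that each use is an application of the channel
`O_{f,d}`. -/
inductive Access : Type
  | sampledOnce
  | fresh

/-- The probability that the algorithm outputs `b` if the underlying function is `f`. -/
def Algorithm.probOn {n d : ℕ} (A : Algorithm n d) (lam : ℝ) (acc : Access)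
    (f : Bits n → Bits n) (b : Bool) : ℝ :=
  match acc with
  | .sampledOnce => 𝔼 σ : Shuffle n d, A.prob lam f (fixedOracle σ f) b
  | .fresh => A.prob lam f (mixedOracle n d f) b

open Classical in
/-- The probability that the algorithm is correct on the `d`-shuffling Simon's problem: with
probability `1/2` the function is uniformly random among the two-to-one functions and `true` is
correct, and otherwise it is uniformly random among the one-to-one functions and `false` is
correct. -/
def Algorithm.successProb {n d : ℕ} (A : Algorithm n d) (lam : ℝ) (P : Promise) (acc : Access) : ℝ :=
  1 / 2 * (𝔼 f ∈ Finset.univ.filter (fun f : Bits n → Bits n => P.Holds f),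
      A.probOn lam acc f true) +
  1 / 2 * (𝔼 f ∈ Finset.univ.filter (fun f : Bits n → Bits n => Function.Injective f),
      A.probOn lam acc f false)

end

end NISQ

open scoped ComplexOrder Matrix

namespace NISQ

/-! ### The depolarizing channel -/

/-! Every use of the oracle is preceded by depolarizing noise, and `f` enters the oracle only
through the last function, which can be nonzero only on the image of the first 2^n strings under the
random permutation `Shuffle.chain`. On the diagonal the noise is an independent flip of each bit
(`noise_diag`), so no m-bit string is reached with probability above (1 - lam/2)^m. Hence the noisy
input register of the last function rarely hits this sparse random set. The state may depend on the
shuffling σ, so the hitting probability has to be bounded by some q(σ) uniformly in the string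
before the noise, with q(σ) small on average. This is `exists_flip_support_bound`, an
exponential-moment argument (`sum_prod_one_add_le`) combined with a union bound over all strings.

If the hitting probability is at most q, one use of the oracle differs in trace norm by at most
2(q/r + r), for any r > 0, from its use with the zero function in place of `f`
(`traceSmall_conj_sub`, `fixedOracle_sub_traceSmall`). With r fixed in advance this is linear in q,
so it can be averaged over σ. A hybrid argument over the layers and over the decision tree
(`foldl_sub_traceSmall`, `Algorithm.abs_prob_sub_le`) replaces all uses at N times this cost.

After that the quantum oracle no longer depends on `f`, and only classical queries carry
information. Queries without a collision have the same law for both classes of functions up to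
normalization, and collisions have probability at most N^2/(2^n - 1). So on every cylinder the
two-to-one class dominates the injective one up to a factor 1 - N^2/(2^n - 1)
(`cylinder_injective_le`), and this passes to output probabilities
(`Algorithm.sum_prob_le_of_cylinders`). The one-sided comparison suffices because the probabilities
of the two outputs sum to one.

For E = exp(n min(1/2, lam d)/4) and d ≥ 1, all errors together are at most 40 N/E + 2 (N/E)^2. For
d = 0 the exponent vanishes and only N ≥ 1 is needed. -/

/-- The coefficients of a Kraus representation of `depol`. -/
noncomputable def krausCoeff (lam : ℝ) : Option (Bool × Bool) → Bool → Bool → ℂ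
  | none, x, u => if x = u then ((Real.sqrt (1 - lam) : ℝ) : ℂ) else 0
  | some (i, j), x, u => if x = i ∧ u = j then ((Real.sqrt (lam / 2) : ℝ) : ℂ) else 0

/-- The identity part of the channel has one Kraus operator, and the map from ρ to (tr ρ) I/2 has
the four operators |i⟩⟨j|/√2. -/
theorem depol_single_eq_sum {lam : ℝ} (h0 : 0 ≤ lam) (h1 : lam ≤ 1) (u v x y : Bool) :
    depol lam (Matrix.single u v 1) x y =
      ∑ a, krausCoeff lam a x u * star (krausCoeff lam a y v) := by
  have e1 : ((Real.sqrt (1 - lam) : ℝ) : ℂ) * ((Real.sqrt (1 - lam) : ℝ) : ℂ) = 1 - lam := by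
    rw [← Complex.ofReal_mul, Real.mul_self_sqrt (by linarith)]; push_cast; ring
  have e2 : ((Real.sqrt (lam / 2) : ℝ) : ℂ) * ((Real.sqrt (lam / 2) : ℝ) : ℂ) = lam / 2 := by
    rw [← Complex.ofReal_mul, Real.mul_self_sqrt (by linarith)]; push_cast; ring
  cases u <;> cases v <;> cases x <;> cases y <;>
    simp [depol, krausCoeff, Fintype.sum_option, Fintype.sum_prod_type, Matrix.trace,
      Matrix.single, e1, e2, -Real.sqrt_div']

/-- The Kraus operators of `noise`. -/
noncomputable def krausOp (lam : ℝ) {k : ℕ} (α : Fin k → Option (Bool × Bool)) : Op k :=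
  Matrix.of fun x u => ∏ i, krausCoeff lam (α i) (x i) (u i)

/-- Expanding the product of the single-qubit Kraus sums. Positivity of the tensor power follows
from this form. -/
theorem noise_eq_sum_kraus {lam : ℝ} (h0 : 0 ≤ lam) (h1 : lam ≤ 1) {k : ℕ} (ρ : Op k) :
    noise lam ρ = ∑ α : Fin k → Option (Bool × Bool), krausOp lam α * ρ * (krausOp lam α)ᴴ := by
  ext x y
  simp only [noise, Matrix.of_apply, Matrix.sum_apply, Matrix.mul_apply, krausOp,
    Matrix.conjTranspose_apply, depol_single_eq_sum h0 h1, Finset.prod_univ_sum,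
    Fintype.piFinset_univ, Finset.mul_sum, Finset.sum_mul, Finset.prod_mul_distrib, star_prod]
  rw [Finset.sum_comm]
  rw [Finset.sum_comm' (t' := Finset.univ) (s' := fun _ => Finset.univ) (by simp)]
  refine Eq.trans (Finset.sum_congr rfl fun v _ => Finset.sum_comm) ?_
  rw [Finset.sum_comm]
  refine Finset.sum_congr rfl fun α _ => ?_
  rw [Finset.sum_comm]
  refine Finset.sum_congr rfl fun v _ => Finset.sum_congr rfl fun u _ => ?_
  ring

theorem noise_posSemidef {lam : ℝ} (h0 : 0 ≤ lam) (h1 : lam ≤ 1) {k : ℕ} {ρ : Op k}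
    (hρ : ρ.PosSemidef) : (noise lam ρ).PosSemidef := by
  rw [noise_eq_sum_kraus h0 h1]
  exact Matrix.posSemidef_sum _ fun α _ => hρ.mul_mul_conjTranspose_same _

theorem noise_sub (lam : ℝ) {k : ℕ} (ρ τ : Op k) :
    noise lam (ρ - τ) = noise lam ρ - noise lam τ := by
  ext x y
  simp [noise, sub_mul, Finset.sum_sub_distrib]

/-- The transition probabilities of a bit under `depol`. -/
noncomputable def flip (lam : ℝ) (u x : Bool) : ℝ := (if u = x then 1 - lam else 0) + lam / 2

theorem flip_nonneg {lam : ℝ} (h0 : 0 ≤ lam) (h1 : lam ≤ 1) (u x : Bool) : 0 ≤ flip lam u x := by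
  unfold flip; split_ifs <;> linarith

theorem flip_le {lam : ℝ} (h1 : lam ≤ 1) (u x : Bool) : flip lam u x ≤ 1 - lam / 2 := by
  unfold flip; split_ifs <;> linarith

theorem sum_flip (lam : ℝ) (u : Bool) : ∑ x, flip lam u x = 1 := by
  cases u <;> simp [flip] <;> ring

theorem depol_single_diag (lam : ℝ) (u v x : Bool) :
    depol lam (Matrix.single u v 1) x x = if u = v then (flip lam u x : ℂ) else 0 := by
  cases u <;> cases v <;> cases x <;> simp [depol, flip, Matrix.trace, Matrix.single]

/-- A single-qubit off-diagonal matrix unit stays off-diagonal under `depol`, so coherences of ρ do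
not contribute: measured in the computational basis, the noise is a classical product channel. -/
theorem noise_diag (lam : ℝ) {k : ℕ} (ρ : Op k) (x : Bits k) :
    noise lam ρ x x = ∑ u, ρ u u * ((∏ i, flip lam (u i) (x i) : ℝ) : ℂ) := by
  simp only [noise, Matrix.of_apply, depol_single_diag]
  refine Finset.sum_congr rfl fun u _ => ?_
  rw [Finset.sum_eq_single u]
  · simp
  · intro v _ hv
    obtain ⟨i, hi⟩ := Function.ne_iff.1 hv
    rw [Finset.prod_eq_zero (Finset.mem_univ i) (by simp [hi.symm]), mul_zero]
  · simp

theorem sum_prod_flip (lam : ℝ) {k : ℕ} (u : Bits k) :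
    ∑ x : Bits k, ∏ i, flip lam (u i) (x i) = 1 := by
  have := Finset.prod_univ_sum (fun _ : Fin k => (Finset.univ : Finset Bool))
    (fun i b => flip lam (u i) b)
  rw [Fintype.piFinset_univ] at this
  rw [← this]; simp only [sum_flip, Finset.prod_const_one]

theorem noise_trace (lam : ℝ) {k : ℕ} (ρ : Op k) : (noise lam ρ).trace = ρ.trace := by
  simp only [Matrix.trace, Matrix.diag_apply, noise_diag]
  rw [Finset.sum_comm]
  refine Finset.sum_congr rfl fun u _ => ?_
  rw [← Finset.mul_sum, ← Complex.ofReal_sum, sum_prod_flip]; simp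

/-- The probability that a restriction of a noisy string equals `w`. -/
theorem sum_prod_flip_restrict (lam : ℝ) {k m : ℕ} (ι : Fin m → Fin k) (hι : ι.Injective)
    (u : Bits k) (w : Bits m) :
    ∑ x : Bits k with (fun j => x (ι j)) = w, ∏ i, flip lam (u i) (x i) =
      ∏ j, flip lam (u (ι j)) (w j) := by
  classical
  -- The event is a product set: coordinates in the range of `ι` are prescribed and all others are
  -- free, the latter contributing a factor 1 each.
  have hset : (Finset.univ.filter fun x : Bits k => (fun j => x (ι j)) = w) =
      Fintype.piFinset fun i : Fin k => Finset.univ.filter fun b : Bool => ∀ j, ι j = i → b = w j := by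
    ext x
    simp only [Finset.mem_filter, Finset.mem_univ, true_and, Fintype.mem_piFinset, funext_iff]
    constructor
    · rintro h i j rfl; exact h j
    · intro h j; exact h _ j rfl
  rw [hset, ← Finset.prod_univ_sum]
  have himg : ∏ j, flip lam (u (ι j)) (w j) = ∏ i ∈ Finset.univ.image ι,
      ∑ b ∈ Finset.univ.filter fun b : Bool => ∀ j, ι j = i → b = w j, flip lam (u i) b := by
    rw [Finset.prod_image hι.injOn]
    refine Finset.prod_congr rfl fun j _ => ?_
    rw [show (Finset.univ.filter fun b : Bool => ∀ j', ι j' = ι j → b = w j') = {w j} by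
      ext b
      simp only [Finset.mem_filter, Finset.mem_univ, true_and, Finset.mem_singleton]
      exact ⟨fun h => h j rfl, fun h j' hj => by rw [hι hj]; exact h⟩]
    simp
  rw [himg]
  symm
  refine Finset.prod_subset (Finset.subset_univ _) fun i _ hi => ?_
  rw [show (Finset.univ.filter fun b : Bool => ∀ j, ι j = i → b = w j) = Finset.univ by
      ext b
      simp only [Finset.mem_filter, Finset.mem_univ, true_and, iff_true]
      intro j hj; exact absurd (Finset.mem_image.2 ⟨j, Finset.mem_univ _, hj⟩) hi]
  exact sum_flip _ _

theorem posSemidef_diag_re_nonneg {k : ℕ} {ρ : Op k} (hρ : ρ.PosSemidef) (x : Bits k) :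
    0 ≤ (ρ x x).re := (Complex.nonneg_iff.1 hρ.diag_nonneg).1

theorem posSemidef_trace_re_nonneg {k : ℕ} {ρ : Op k} (hρ : ρ.PosSemidef) :
    0 ≤ ρ.trace.re := (Complex.nonneg_iff.1 hρ.trace_nonneg).1

/-- If every string is mapped into `S` with probability at most `q` by the noise, then the registers
`ι` of a noisy state lie in `S` with probability at most `q`. -/
theorem noise_mass_le {lam : ℝ} {k m : ℕ} (ι : Fin m → Fin k)
    (hι : ι.Injective) (S : Finset (Bits m)) (q : ℝ)
    (hq : ∀ z : Bits m, ∑ w ∈ S, ∏ j, flip lam (z j) (w j) ≤ q) {ρ : Op k} (hρ : ρ.PosSemidef) :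
    ∑ x : Bits k with (fun j => x (ι j)) ∈ S, (noise lam ρ x x).re ≤ q * ρ.trace.re := by
  classical
  have hre : ∀ x, (noise lam ρ x x).re = ∑ u, (ρ u u).re * ∏ i, flip lam (u i) (x i) := by
    intro x
    rw [noise_diag, Complex.re_sum]
    simp only [Complex.re_mul_ofReal]
  simp only [hre]
  rw [Finset.sum_comm]
  have ht : q * ρ.trace.re = ∑ u, (ρ u u).re * q := by
    rw [Matrix.trace, Complex.re_sum, Finset.mul_sum]
    exact Finset.sum_congr rfl fun u _ => mul_comm _ _
  rw [ht]
  refine Finset.sum_le_sum fun u _ => ?_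
  rw [← Finset.mul_sum]
  refine mul_le_mul_of_nonneg_left ?_ (posSemidef_diag_re_nonneg hρ u)
  refine le_trans (le_of_eq ?_) (hq fun j => u (ι j))
  rw [← Finset.sum_fiberwise_of_maps_to (s := Finset.univ.filter fun x : Bits k =>
    (fun j => x (ι j)) ∈ S) (t := S) (g := fun x j => x (ι j)) (by simp)]
  refine Finset.sum_congr rfl fun w hw => ?_
  rw [← sum_prod_flip_restrict lam ι hι u w, Finset.filter_filter]
  refine Finset.sum_congr (Finset.filter_congr fun x _ => ?_) fun _ _ => rfl
  exact ⟨fun h => h.2, fun h => ⟨by rw [h]; exact hw, h⟩⟩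

/-! ### Differences of states -/

/-- The trace norm of `X` is at most `δ`, witnessed by a difference of positive operators. -/
def TraceSmall {k : ℕ} (δ : ℝ) (X : Op k) : Prop :=
  ∃ A B : Op k, A.PosSemidef ∧ B.PosSemidef ∧ X = A - B ∧ A.trace.re + B.trace.re ≤ δ

theorem TraceSmall.zero {k : ℕ} : TraceSmall 0 (0 : Op k) :=
  ⟨0, 0, Matrix.PosSemidef.zero, Matrix.PosSemidef.zero, by simp, by simp⟩

theorem TraceSmall.add {k : ℕ} {δ ε : ℝ} {X Y : Op k} (hX : TraceSmall δ X)
    (hY : TraceSmall ε Y) : TraceSmall (δ + ε) (X + Y) := by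
  obtain ⟨A, B, hA, hB, rfl, h⟩ := hX
  obtain ⟨C, D, hC, hD, rfl, h'⟩ := hY
  refine ⟨A + C, B + D, hA.add hC, hB.add hD, by abel, ?_⟩
  simp only [Matrix.trace_add, Complex.add_re]; linarith

theorem TraceSmall.sum_abs_diag_le {k : ℕ} {δ : ℝ} {X : Op k} (hX : TraceSmall δ X) :
    ∑ x, |(X x x).re| ≤ δ := by
  obtain ⟨A, B, hA, hB, rfl, h⟩ := hX
  refine le_trans ?_ h
  rw [Matrix.trace, Matrix.trace, Complex.re_sum, Complex.re_sum, ← Finset.sum_add_distrib]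
  refine Finset.sum_le_sum fun x _ => ?_
  have h1 := posSemidef_diag_re_nonneg hA x
  have h2 := posSemidef_diag_re_nonneg hB x
  simp only [Matrix.sub_apply, Complex.sub_re, Matrix.diag_apply]
  rw [abs_le]; constructor <;> linarith

/-- A positive trace-preserving map that respects differences. -/
structure IsChannel {k : ℕ} (Φ : Op k → Op k) : Prop where
  sub : ∀ ρ τ, Φ (ρ - τ) = Φ ρ - Φ τ
  pos : ∀ ρ, ρ.PosSemidef → (Φ ρ).PosSemidef
  trace : ∀ ρ, (Φ ρ).trace = ρ.trace

theorem IsChannel.traceSmall {k : ℕ} {Φ : Op k → Op k} (hΦ : IsChannel Φ) {δ : ℝ} {X : Op k}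
    (hX : TraceSmall δ X) : TraceSmall δ (Φ X) := by
  obtain ⟨A, B, hA, hB, rfl, h⟩ := hX
  exact ⟨Φ A, Φ B, hΦ.pos _ hA, hΦ.pos _ hB, hΦ.sub _ _, by simpa only [hΦ.trace] using h⟩

theorem isChannel_noise {lam : ℝ} (h0 : 0 ≤ lam) (h1 : lam ≤ 1) (k : ℕ) :
    IsChannel (noise lam (k := k)) :=
  ⟨noise_sub lam, fun _ => noise_posSemidef h0 h1, noise_trace lam⟩

theorem isChannel_conj {k : ℕ} {U : Op k} (hU : Uᴴ * U = 1) : IsChannel fun ρ => U * ρ * Uᴴ where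
  sub ρ τ := by rw [mul_sub, sub_mul]
  pos ρ hρ := hρ.mul_mul_conjTranspose_same _
  trace ρ := by rw [Matrix.trace_mul_comm, ← mul_assoc, hU, one_mul]

theorem TraceSmall.smul {k : ℕ} {δ c : ℝ} (hc : 0 ≤ c) {X : Op k} (hX : TraceSmall δ X) :
    TraceSmall (c * δ) ((c : ℂ) • X) := by
  obtain ⟨A, B, hA, hB, rfl, h⟩ := hX
  have hc' : (0 : ℂ) ≤ c := by exact_mod_cast hc
  refine ⟨(c : ℂ) • A, (c : ℂ) • B, hA.smul hc', hB.smul hc', smul_sub _ _ _, ?_⟩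
  simp only [Matrix.trace_smul, smul_eq_mul, Complex.re_ofReal_mul]
  rw [← mul_add]
  exact mul_le_mul_of_nonneg_left h hc

theorem TraceSmall.sum {k : ℕ} {ι : Type} (s : Finset ι) {δ : ι → ℝ} {X : ι → Op k}
    (hX : ∀ i, TraceSmall (δ i) (X i)) : TraceSmall (∑ i ∈ s, δ i) (∑ i ∈ s, X i) := by
  classical
  induction s using Finset.induction_on with
  | empty => simpa using TraceSmall.zero
  | insert i s hi ih => rw [Finset.sum_insert hi, Finset.sum_insert hi]; exact (hX i).add ih

theorem expect_op_eq {k : ℕ} {ι : Type} [Fintype ι] (X : ι → Op k) :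
    𝔼 i, X i = (((Fintype.card ι : ℝ)⁻¹ : ℝ) : ℂ) • ∑ i, X i := by
  rw [Finset.expect, Finset.card_univ]
  ext x y
  simp [NNRat.smul_def]

theorem expect_real_eq {ι : Type} [Fintype ι] (X : ι → ℝ) :
    𝔼 i, X i = (Fintype.card ι : ℝ)⁻¹ * ∑ i, X i := by
  rw [Fintype.expect_eq_sum_div_card, div_eq_inv_mul]

theorem isChannel_expect {k : ℕ} {ι : Type} [Fintype ι] [Nonempty ι] {Φ : ι → Op k → Op k}
    (hΦ : ∀ i, IsChannel (Φ i)) : IsChannel fun ρ => 𝔼 i, Φ i ρ where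
  sub ρ τ := by simp only [(hΦ _).sub, Finset.expect_sub_distrib]
  pos ρ hρ := by
    rw [expect_op_eq]
    refine (Matrix.posSemidef_sum _ fun i _ => (hΦ i).pos _ hρ).smul ?_
    exact_mod_cast inv_nonneg.2 (Nat.cast_nonneg (α := ℝ) (Fintype.card ι))
  trace ρ := by
    rw [expect_op_eq, Matrix.trace_smul, Matrix.trace_sum]
    simp only [(hΦ _).trace, Finset.sum_const, Finset.card_univ, nsmul_eq_mul, smul_eq_mul]
    push_cast
    rw [← mul_assoc, inv_mul_cancel₀ (by simp), one_mul]

theorem traceSmall_expect {k : ℕ} {ι : Type} [Fintype ι] {δ : ι → ℝ} {X : ι → Op k}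
    (hX : ∀ i, TraceSmall (δ i) (X i)) : TraceSmall (𝔼 i, δ i) (𝔼 i, X i) := by
  rw [expect_op_eq, expect_real_eq]
  exact (TraceSmall.sum Finset.univ hX).smul (by positivity)

/-- The difference of two conjugations of a state is small if they agree outside of a set of small
mass. -/
theorem traceSmall_conj_sub {k : ℕ} {F G : Op k} (hF : Fᴴ * F = 1) (hG : Gᴴ * G = 1)
    (S : Finset (Bits k)) (hS : ∀ x y, y ∉ S → F x y = G x y) {ρ : Op k} (hρ : ρ.PosSemidef)
    (hρ1 : ρ.trace.re ≤ 1) {q r : ℝ} (hr : 0 < r) (hq : ∑ x ∈ S, (ρ x x).re ≤ q) :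
    TraceSmall (2 * (q / r + r)) (F * ρ * Fᴴ - G * ρ * Gᴴ) := by
  classical
  set D := F - G with hD
  set E := F + G with hE
  -- The parallelogram law; it bounds the traces of both the difference and the sum part by four
  -- times the trace of the state.
  have par : ∀ τ : Op k, (D * τ * Dᴴ).trace.re + (E * τ * Eᴴ).trace.re = 4 * τ.trace.re := by
    intro τ
    have h1 : D * τ * Dᴴ + E * τ * Eᴴ = (2 : ℂ) • (F * τ * Fᴴ) + (2 : ℂ) • (G * τ * Gᴴ) := by
      simp only [hD, hE, Matrix.conjTranspose_sub, Matrix.conjTranspose_add, two_smul]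
      noncomm_ring
    rw [← Complex.add_re, ← Matrix.trace_add, h1, Matrix.trace_add, Matrix.trace_smul,
      Matrix.trace_smul, (isChannel_conj hF).trace, (isChannel_conj hG).trace]
    simp; ring
  set Q : Op k := Matrix.diagonal fun x => if x ∈ S then 1 else 0 with hQ
  have hQh : Qᴴ = Q := by
    rw [hQ, Matrix.diagonal_conjTranspose]; congr 1; ext x; simp [apply_ite]
  -- The columns of `D` outside `S` vanish, so `D` only sees the part of ρ compressed to `S`, which
  -- has trace at most `q`.
  have hDQ : D * Q = D := by
    ext x y
    rw [hQ, Matrix.mul_diagonal]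
    by_cases hy : y ∈ S
    · simp [hy]
    · simp [hy, hD, hS x y hy]
  have hDtr : (D * ρ * Dᴴ).trace.re ≤ 4 * q := by
    have h1 : D * ρ * Dᴴ = D * (Q * ρ * Qᴴ) * Dᴴ := by
      conv_lhs => rw [← hDQ]
      rw [Matrix.conjTranspose_mul]; simp only [mul_assoc]
    have h2 : (Q * ρ * Qᴴ).trace.re = ∑ x ∈ S, (ρ x x).re := by
      rw [hQh, Matrix.trace, Complex.re_sum]
      simp only [hQ, Matrix.diag_apply, Matrix.mul_diagonal, Matrix.diagonal_mul]
      rw [← Finset.sum_filter_add_sum_filter_not Finset.univ (· ∈ S)]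
      rw [Finset.filter_univ_mem, Finset.sum_congr rfl (g := fun x => (ρ x x).re)
        fun x hx => by simp [hx], Finset.sum_eq_zero (s := Finset.univ.filter (· ∉ S))
        fun x hx => by simp [(Finset.mem_filter.1 hx).2], add_zero]
    have h3 := posSemidef_trace_re_nonneg
      ((hρ.mul_mul_conjTranspose_same Q).mul_mul_conjTranspose_same E)
    have h4 := par (Q * ρ * Qᴴ)
    rw [h1]; linarith
  have hEtr : (E * ρ * Eᴴ).trace.re ≤ 4 := by
    have h3 := posSemidef_trace_re_nonneg (hρ.mul_mul_conjTranspose_same D)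
    have h4 := par ρ
    linarith
  set w := Real.sqrt r
  have hw : 0 < w := Real.sqrt_pos.2 hr
  have hww : (w : ℂ) ≠ 0 := by exact_mod_cast hw.ne'
  have hwr : w * w = r := Real.mul_self_sqrt hr.le
  -- Polarization: the cross terms DρE* + ED-adjoint counterpart equal twice the difference to be
  -- bounded, and they are a difference of the positive operators obtained for c = 1 and c = -1. The
  -- weight `w` = √r balances the small part `D` against the large part `E`.
  have key : ∀ c : ℂ, star c = c → (((c * (w : ℂ)⁻¹) • D + (w : ℂ) • E) * ρ *
      ((c * (w : ℂ)⁻¹) • D + (w : ℂ) • E)ᴴ) = (c * c * ((r⁻¹ : ℝ) : ℂ)) • (D * ρ * Dᴴ) +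
        (r : ℂ) • (E * ρ * Eᴴ) + c • (D * ρ * Eᴴ + E * ρ * Dᴴ) := by
    intro c hc
    have e1 : star ((w : ℂ)) = w := Complex.conj_ofReal w
    have e2 : (r : ℂ) = w * w := by rw [← hwr]; push_cast; rfl
    simp only [Matrix.conjTranspose_add, Matrix.conjTranspose_smul, star_mul', hc, star_inv₀, e1,
      add_mul, mul_add, smul_mul_assoc, mul_smul_comm, smul_add, smul_smul, Complex.ofReal_inv, e2]
    have e3 : (c * (w : ℂ)⁻¹) * w = c := by field_simp
    have e4 : (w : ℂ) * (c * (w : ℂ)⁻¹) = c := by field_simp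
    rw [e3, e4, mul_inv, show c * (w : ℂ)⁻¹ * (c * (w : ℂ)⁻¹) = c * c * ((w : ℂ)⁻¹ * (w : ℂ)⁻¹) by
      ring]
    abel
  have k1 := key 1 (star_one _)
  have k2 := key (-1) (by simp)
  set A := (((1 * (w : ℂ)⁻¹) • D + (w : ℂ) • E) * ρ * ((1 * (w : ℂ)⁻¹) • D + (w : ℂ) • E)ᴴ)
  set B := (((-1 * (w : ℂ)⁻¹) • D + (w : ℂ) • E) * ρ * ((-1 * (w : ℂ)⁻¹) • D + (w : ℂ) • E)ᴴ)
  have hA : A.PosSemidef := hρ.mul_mul_conjTranspose_same _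
  have hB : B.PosSemidef := hρ.mul_mul_conjTranspose_same _
  have h4 : (0 : ℂ) ≤ ((1 / 4 : ℝ) : ℂ) := by
    exact_mod_cast (by norm_num : (0 : ℝ) ≤ 1 / 4)
  refine ⟨((1 / 4 : ℝ) : ℂ) • A, ((1 / 4 : ℝ) : ℂ) • B, hA.smul h4, hB.smul h4, ?_, ?_⟩
  · have h5 : D * ρ * Eᴴ + E * ρ * Dᴴ = (2 : ℂ) • (F * ρ * Fᴴ - G * ρ * Gᴴ) := by
      simp only [hD, hE, Matrix.conjTranspose_sub, Matrix.conjTranspose_add, two_smul]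
      noncomm_ring
    rw [k1, k2, h5]
    module
  · have tA : A.trace.re + B.trace.re =
        2 * (r⁻¹ * (D * ρ * Dᴴ).trace.re + r * (E * ρ * Eᴴ).trace.re) := by
      rw [← Complex.add_re, ← Matrix.trace_add, k1, k2]
      have : ((1 * 1 * ((r⁻¹ : ℝ) : ℂ)) • (D * ρ * Dᴴ) + (r : ℂ) • (E * ρ * Eᴴ) +
          (1 : ℂ) • (D * ρ * Eᴴ + E * ρ * Dᴴ)) + ((-1 * -1 * ((r⁻¹ : ℝ) : ℂ)) • (D * ρ * Dᴴ) +
          (r : ℂ) • (E * ρ * Eᴴ) + (-1 : ℂ) • (D * ρ * Eᴴ + E * ρ * Dᴴ)) =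
          ((2 * r⁻¹ : ℝ) : ℂ) • (D * ρ * Dᴴ) + ((2 * r : ℝ) : ℂ) • (E * ρ * Eᴴ) := by
        push_cast; module
      rw [this, Matrix.trace_add, Matrix.trace_smul, Matrix.trace_smul, Complex.add_re,
        smul_eq_mul, smul_eq_mul, Complex.re_ofReal_mul, Complex.re_ofReal_mul]
      ring
    simp only [Matrix.trace_smul, smul_eq_mul, Complex.re_ofReal_mul]
    have h6 : r⁻¹ * (D * ρ * Dᴴ).trace.re ≤ r⁻¹ * (4 * q) :=
      mul_le_mul_of_nonneg_left hDtr (inv_nonneg.2 hr.le)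
    have h7 : r * (E * ρ * Eᴴ).trace.re ≤ r * 4 := mul_le_mul_of_nonneg_left hEtr hr.le
    rw [← mul_add, tA, div_eq_inv_mul q r]
    linarith

/-! ### Unitarity of depth-one layers. -/

/-- The restrictions of a bit string to the parts of a partition. -/
theorem Finpartition_restrict_bijective {k : ℕ}
    (P : Finpartition (Finset.univ : Finset (Fin k))) :
    Function.Bijective fun (x : Bits k) (B : P.parts) (i : B.1) => x i := by
  constructor
  · intro x y h
    ext i
    exact congrFun (congrFun h ⟨P.part i, P.part_mem.2 (Finset.mem_univ i)⟩)
      ⟨i, P.mem_part (Finset.mem_univ i)⟩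
  · intro w
    refine ⟨fun i => w ⟨P.part i, P.part_mem.2 (Finset.mem_univ i)⟩
      ⟨i, P.mem_part (Finset.mem_univ i)⟩, ?_⟩
    ext B i
    have aux : ∀ (C : P.parts) (hi : i.1 ∈ C.1), C = B → w C ⟨i.1, hi⟩ = w B i := by
      rintro C hi rfl; rfl
    exact aux _ _ (Subtype.ext (P.part_eq_of_mem B.2 i.2))

/-- Bit strings are tuples of strings on the blocks, so the sum over the inner index factors into
one sum per block, where unitarity of the block applies. -/
theorem IsDepthOne.conjTranspose_mul_self {k : ℕ} {U : Op k} (hU : IsDepthOne U) :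
    Uᴴ * U = 1 := by
  obtain ⟨P, V, -, hV, hUV⟩ := hU
  ext y z
  have hsum : ∀ x, Uᴴ y x * U x z = ∏ B : P.parts,
      (star (V B.1 (fun i => x i) fun i => y i) * V B.1 (fun i => x i) fun i => z i) := by
    intro x
    rw [Matrix.conjTranspose_apply, hUV, hUV, star_prod, ← Finset.prod_mul_distrib,
      ← Finset.prod_coe_sort P.parts]
  rw [Matrix.mul_apply]
  simp only [hsum]
  have hprod : ∀ T : (B : P.parts) → (B.1 → Bool) → ℂ,
      ∑ x : Bits k, ∏ B : P.parts, T B (fun i => x i) = ∏ B, ∑ x, T B x := by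
    intro T
    rw [(Finpartition_restrict_bijective P).sum_comp (fun g : (B : P.parts) → (B.1 → Bool) =>
      ∏ B : P.parts, T B (g B)), Finset.prod_univ_sum, Fintype.piFinset_univ]
  rw [hprod fun B x => star (V B.1 x fun i => y i) * V B.1 x fun i => z i]
  have hB : ∀ B : P.parts, ∑ x, star (V B.1 x fun i => y i) * V B.1 x (fun i => z i) =
      if (fun i : B.1 => y i) = (fun i : B.1 => z i) then 1 else 0 := by
    intro B
    have := congrFun (congrFun (Matrix.mem_unitaryGroup_iff'.1 (hV B.1 B.2)) fun i => y i)
      fun i => z i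
    rw [Matrix.mul_apply, Matrix.one_apply] at this
    simpa only [Matrix.star_apply] using this
  simp only [hB, Matrix.one_apply]
  by_cases hyz : y = z
  · simp [hyz]
  · rw [if_neg hyz]
    have := (Finpartition_restrict_bijective P).1.ne hyz
    obtain ⟨B, hB'⟩ := Function.ne_iff.1 this
    exact Finset.prod_eq_zero (Finset.mem_univ B) (if_neg hB')

/-! ### The shuffling oracle as a channel -/

theorem Shuffle.act_apply_input {n d k : ℕ} (σ : Shuffle n d) (f : Bits n → Bits n)
    (e : OracleQubit n d ↪ Fin k) (z : Bits k) (t : Fin (d + 1) × Fin ((d + 2) * n)) :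
    σ.act f e z (e (Sum.inl t)) = z (e (Sum.inl t)) := by
  simp [Shuffle.act, e.injective.extend_apply]

/-- The input registers are preserved, so the second XOR adds the same values and cancels the first.
-/
theorem Shuffle.act_involutive {n d k : ℕ} (σ : Shuffle n d) (f : Bits n → Bits n)
    (e : OracleQubit n d ↪ Fin k) : Function.Involutive (σ.act f e) := by
  intro z
  ext q
  have h : ∀ z', (∀ t, z' (e (Sum.inl t)) = z (e (Sum.inl t))) →
      σ.act f e z' q = xor (z' q) (Function.extend e (Sum.elim (fun _ => false)
        (fun t => σ.fn f t.1 (fun j => z (e (Sum.inl (t.1, j)))) t.2)) (fun _ => false) q) := by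
    intro z' hz'
    simp only [Shuffle.act, hz']
  rw [h _ fun t => σ.act_apply_input f e z t, h z fun _ => rfl]
  simp

theorem Shuffle.unitary_conjTranspose_mul_self {n d k : ℕ} (σ : Shuffle n d)
    (f : Bits n → Bits n) (e : OracleQubit n d ↪ Fin k) :
    (σ.unitary f e)ᴴ * σ.unitary f e = 1 := by
  ext a b
  simp only [Matrix.mul_apply, Matrix.conjTranspose_apply, Shuffle.unitary, Matrix.of_apply,
    Matrix.one_apply]
  simp [apply_ite, (σ.act_involutive f e).injective.eq_iff, eq_comm]

/-- Every use of the oracle is a channel. -/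
def Oracle.IsChannel {n d : ℕ} (O : Oracle n d) : Prop := ∀ k e, NISQ.IsChannel (O k e)

theorem fixedOracle_isChannel {n d : ℕ} (σ : Shuffle n d) (f : Bits n → Bits n) :
    (fixedOracle σ f).IsChannel := fun _ e =>
  isChannel_conj (σ.unitary_conjTranspose_mul_self f e)

theorem mixedOracle_isChannel {n d : ℕ} (f : Bits n → Bits n) :
    (mixedOracle n d f).IsChannel := fun k e =>
  isChannel_expect fun σ => fixedOracle_isChannel σ f k e

theorem Layer.isChannel_apply {n d k : ℕ} {O : Oracle n d} (hO : O.IsChannel) (l : Layer n d k) :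
    IsChannel (l.apply O) := by
  cases l with
  | gates U hU => exact isChannel_conj hU.conjTranspose_mul_self
  | query e => exact hO k e

/-- The set on which the last function of a shuffling can be nonzero. -/
def Shuffle.support {n d : ℕ} (σ : Shuffle n d) : Finset (Bits ((d + 2) * n)) :=
  Finset.univ.image fun x : Bits n => σ.chain (embed n d x)

theorem embed_injective (n d : ℕ) : Function.Injective (embed n d) := by
  intro x y h
  ext i
  have hm : (d + 2) * n = (d + 1) * n + n := by ring
  have := congrFun h ⟨(d + 1) * n + i, by omega⟩
  simpa [embed] using this

/-- Only the last of the functions involves `f`, and off the support it is zero whatever `f` is. -/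
theorem Shuffle.act_eq_of_notMem_support {n d k : ℕ} (σ : Shuffle n d) (f : Bits n → Bits n)
    (e : OracleQubit n d ↪ Fin k) (z : Bits k)
    (hz : (fun j => z (e (Sum.inl (Fin.last d, j)))) ∉ σ.support) :
    σ.act f e z = σ.act (fun _ _ => false) e z := by
  have hfn : ∀ t : Fin (d + 1), σ.fn f t (fun j => z (e (Sum.inl (t, j)))) =
      σ.fn (fun _ _ => false) t (fun j => z (e (Sum.inl (t, j)))) := by
    intro t
    unfold Shuffle.fn
    split_ifs with ht
    · rfl
    · obtain rfl : t = Fin.last d := by ext; have := t.isLt; simp; omega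
      have hno : ¬ ∃ x : Bits n, σ.chain (embed n d x) =
          fun j => z (e (Sum.inl (Fin.last d, j))) := by
        rintro ⟨x, hx⟩
        exact hz (Finset.mem_image.2 ⟨x, Finset.mem_univ _, hx⟩)
      simp only [Shuffle.last, dif_neg hno]
  unfold Shuffle.act
  simp only [hfn]

/-- The oracle is close to the one for the zero function, on noisy states. -/
theorem fixedOracle_sub_traceSmall {n d : ℕ} (σ : Shuffle n d) (f : Bits n → Bits n) {lam : ℝ}
    (h0 : 0 ≤ lam) (h1 : lam ≤ 1) {q r : ℝ} (hr : 0 < r) (hq0 : 0 ≤ q)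
    (hq : ∀ z : Bits ((d + 2) * n), ∑ w ∈ σ.support, ∏ j, flip lam (z j) (w j) ≤ q)
    (k : ℕ) (e : OracleQubit n d ↪ Fin k) {ρ : Op k} (hρ : ρ.PosSemidef) (hρ1 : ρ.trace.re ≤ 1) :
    TraceSmall (2 * (q / r + r)) (fixedOracle σ f k e (noise lam ρ) -
      fixedOracle σ (fun _ _ => false) k e (noise lam ρ)) := by
  refine traceSmall_conj_sub (σ.unitary_conjTranspose_mul_self f e)
    (σ.unitary_conjTranspose_mul_self _ e)
    (Finset.univ.filter fun x : Bits k => (fun j => x (e (Sum.inl (Fin.last d, j)))) ∈ σ.support)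
    ?_ (noise_posSemidef h0 h1 hρ) (by rwa [noise_trace]) hr ?_
  · intro x y hy
    rw [Finset.mem_filter, not_and] at hy
    simp only [Shuffle.unitary, Matrix.of_apply,
      σ.act_eq_of_notMem_support f e y (hy (Finset.mem_univ y))]
  · refine (noise_mass_le (lam := lam) (fun j => e (Sum.inl (Fin.last d, j))) ?_ σ.support q hq
      hρ).trans ?_
    · intro i j h
      simpa using e.injective h
    · exact mul_le_of_le_one_right hq0 hρ1

/-! ### Replacing the oracle in a circuit and in an algorithm -/

/-- The oracles differ by at most `δ` on noisy states. -/
def Oracle.Close {n d : ℕ} (lam δ : ℝ) (O O' : Oracle n d) : Prop :=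
  ∀ (k : ℕ) (e : OracleQubit n d ↪ Fin k) (ρ : Op k), ρ.PosSemidef → ρ.trace.re ≤ 1 →
    TraceSmall δ (O k e (noise lam ρ) - O' k e (noise lam ρ))

theorem Layer.apply_sub_traceSmall {n d k : ℕ} {O O' : Oracle n d} {lam δ : ℝ}
    (h : O.Close lam δ O') (l : Layer n d k) {ρ : Op k} (hρ : ρ.PosSemidef)
    (hρ1 : ρ.trace.re ≤ 1) :
    TraceSmall (l.cost * δ) (l.apply O (noise lam ρ) - l.apply O' (noise lam ρ)) := by
  cases l with
  | gates U hU => simpa [Layer.apply, Layer.cost] using TraceSmall.zero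
  | query e => simpa [Layer.apply, Layer.cost] using h k e ρ hρ hρ1

/-- Hybrid argument over the layers. The reference state is kept in the form `noise lam τ`, since
closeness of the oracles is only available on noisy states; the error `η` accumulated by the other
state is carried along by channels, which do not increase it. -/
theorem foldl_sub_traceSmall {n d k : ℕ} {O O' : Oracle n d} (hO : O.IsChannel)
    (hO' : O'.IsChannel) {lam δ : ℝ} (h0 : 0 ≤ lam) (h1 : lam ≤ 1) (h : O.Close lam δ O')
    (L : List (Layer n d k)) : ∀ (η : ℝ) (ρ τ : Op k), τ.PosSemidef → τ.trace.re ≤ 1 →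
      TraceSmall η (ρ - noise lam τ) →
      TraceSmall (η + (L.map Layer.cost).sum * δ)
        (L.foldl (fun ρ l => noise lam (l.apply O ρ)) ρ -
          L.foldl (fun ρ l => noise lam (l.apply O' ρ)) (noise lam τ)) := by
  induction L with
  | nil => intro η ρ τ _ _ hη; simpa using hη
  | cons l L ih =>
    intro η ρ τ hτ hτ1 hη
    have hl' := l.isChannel_apply hO'
    have hN := isChannel_noise h0 h1 k
    have step : TraceSmall (η + l.cost * δ)
        (noise lam (l.apply O ρ) - noise lam (l.apply O' (noise lam τ))) := by
      rw [← hN.sub]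
      refine hN.traceSmall ?_
      have := ((l.isChannel_apply hO).traceSmall hη).add (l.apply_sub_traceSmall h hτ hτ1)
      rwa [(l.isChannel_apply hO).sub, sub_add_sub_cancel] at this
    have := ih _ _ _ (hl'.pos _ (hN.pos _ hτ)) (by rwa [hl'.trace, hN.trace]) step
    simp only [List.foldl_cons, List.map_cons, List.sum_cons]
    rw [Nat.cast_add]
    convert this using 1
    ring

theorem posSemidef_initial (k : ℕ) :
    (Matrix.single (fun _ => false) (fun _ => false) 1 : Op k).PosSemidef := by
  have : (Matrix.single (fun _ => false) (fun _ => false) 1 : Op k) =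
      Matrix.diagonal (Pi.single (fun _ => false) 1) := by
    rw [Matrix.diagonal_single]
  rw [this]
  refine Matrix.PosSemidef.diagonal fun x => ?_
  by_cases hx : x = fun _ => false
  · subst hx; simp
  · simp [Pi.single_eq_of_ne hx]

theorem finalState_sub_traceSmall {n d k : ℕ} {O O' : Oracle n d} (hO : O.IsChannel)
    (hO' : O'.IsChannel) {lam δ : ℝ} (h0 : 0 ≤ lam) (h1 : lam ≤ 1) (h : O.Close lam δ O')
    (L : List (Layer n d k)) :
    TraceSmall ((L.map Layer.cost).sum * δ) (finalState lam O L - finalState lam O' L) := by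
  have := foldl_sub_traceSmall hO hO' h0 h1 h L 0 _ _ (posSemidef_initial k) (by simp)
    (by rw [sub_self]; exact TraceSmall.zero)
  simpa [finalState] using this

theorem finalState_posSemidef_trace {n d k : ℕ} {O : Oracle n d} (hO : O.IsChannel)
    {lam : ℝ} (h0 : 0 ≤ lam) (h1 : lam ≤ 1) (L : List (Layer n d k)) :
    (finalState lam O L).PosSemidef ∧ (finalState lam O L).trace = 1 := by
  have hN := isChannel_noise h0 h1 k
  have main : ∀ (L : List (Layer n d k)) (ρ : Op k), ρ.PosSemidef ∧ ρ.trace = 1 →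
      (L.foldl (fun ρ l => noise lam (l.apply O ρ)) ρ).PosSemidef ∧
      (L.foldl (fun ρ l => noise lam (l.apply O ρ)) ρ).trace = 1 := by
    intro L
    induction L with
    | nil => exact fun ρ h => h
    | cons l L ih =>
      intro ρ h
      have hl := l.isChannel_apply hO
      exact ih _ ⟨hN.pos _ (hl.pos _ h.1), by rw [hN.trace, hl.trace, h.2]⟩
  exact main L _ ⟨hN.pos _ (posSemidef_initial k), by rw [hN.trace]; simp⟩

theorem outputProb_nonneg {n d k : ℕ} {O : Oracle n d} (hO : O.IsChannel)
    {lam : ℝ} (h0 : 0 ≤ lam) (h1 : lam ≤ 1) (L : List (Layer n d k)) (s : Bits k) :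
    0 ≤ outputProb lam O L s :=
  posSemidef_diag_re_nonneg (finalState_posSemidef_trace hO h0 h1 L).1 s

theorem sum_outputProb {n d k : ℕ} {O : Oracle n d} (hO : O.IsChannel)
    {lam : ℝ} (h0 : 0 ≤ lam) (h1 : lam ≤ 1) (L : List (Layer n d k)) :
    ∑ s, outputProb lam O L s = 1 := by
  have := congrArg Complex.re (finalState_posSemidef_trace hO h0 h1 L).2
  rwa [Matrix.trace, Complex.re_sum, Complex.one_re] at this

theorem sum_abs_outputProb_sub_le {n d k : ℕ} {O O' : Oracle n d} (hO : O.IsChannel)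
    (hO' : O'.IsChannel) {lam δ : ℝ} (h0 : 0 ≤ lam) (h1 : lam ≤ 1) (h : O.Close lam δ O')
    (L : List (Layer n d k)) :
    ∑ s, |outputProb lam O L s - outputProb lam O' L s| ≤ (L.map Layer.cost).sum * δ := by
  simpa [outputProb] using (finalState_sub_traceSmall hO hO' h0 h1 h L).sum_abs_diag_le

/-! ### Output probabilities of decision trees. -/

theorem PMF.summable_toReal (p : PMF ℕ) : Summable fun i => (p i).toReal :=
  ENNReal.summable_toReal p.tsum_coe_ne_top

theorem PMF.tsum_toReal (p : PMF ℕ) : ∑' i, (p i).toReal = 1 := by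
  rw [← ENNReal.tsum_toReal_eq p.apply_ne_top, p.tsum_coe, ENNReal.toReal_one]

theorem PMF.summable_toReal_mul (p : PMF ℕ) {g : ℕ → ℝ} {C : ℝ} (hg : ∀ i, |g i| ≤ C) :
    Summable fun i => (p i).toReal * g i := by
  refine Summable.of_norm_bounded (g := fun i => (p i).toReal * C)
    ((PMF.summable_toReal p).mul_right C) fun i => ?_
  rw [Real.norm_eq_abs, abs_mul, abs_of_nonneg ENNReal.toReal_nonneg]
  exact mul_le_mul_of_nonneg_left (hg i) ENNReal.toReal_nonneg

theorem Algorithm.prob_nonneg_and_le_one {n d : ℕ} {O : Oracle n d} (hO : O.IsChannel)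
    {lam : ℝ} (h0 : 0 ≤ lam) (h1 : lam ≤ 1) (f : Bits n → Bits n) (b : Bool)
    (A : Algorithm n d) : 0 ≤ A.prob lam f O b ∧ A.prob lam f O b ≤ 1 := by
  induction A with
  | output c => simp only [Algorithm.prob]; split_ifs <;> norm_num
  | toss p next ih =>
    simp only [Algorithm.prob]
    have hs : Summable fun i => (p i).toReal * (next i).prob lam f O b :=
      PMF.summable_toReal_mul p (C := 1) fun i => by rw [abs_of_nonneg (ih i).1]; exact (ih i).2
    refine ⟨tsum_nonneg fun i => mul_nonneg ENNReal.toReal_nonneg (ih i).1, ?_⟩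
    rw [← PMF.tsum_toReal p]
    exact hs.tsum_le_tsum (fun i => mul_le_of_le_one_right ENNReal.toReal_nonneg (ih i).2)
      (PMF.summable_toReal p)
  | classical x next ih => exact ih _
  | circuit k L next ih =>
    simp only [Algorithm.prob]
    refine ⟨Finset.sum_nonneg fun s _ => mul_nonneg (outputProb_nonneg hO h0 h1 L s) (ih s).1, ?_⟩
    rw [← sum_outputProb hO h0 h1 L]
    exact Finset.sum_le_sum fun s _ =>
      mul_le_of_le_one_right (outputProb_nonneg hO h0 h1 L s) (ih s).2

theorem Algorithm.abs_prob_le_one {n d : ℕ} {O : Oracle n d} (hO : O.IsChannel)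
    {lam : ℝ} (h0 : 0 ≤ lam) (h1 : lam ≤ 1) (f : Bits n → Bits n) (b : Bool)
    (A : Algorithm n d) : |A.prob lam f O b| ≤ 1 := by
  have := A.prob_nonneg_and_le_one hO h0 h1 f b
  rw [abs_of_nonneg this.1]; exact this.2

theorem Algorithm.prob_true_add_prob_false {n d : ℕ} {O : Oracle n d} (hO : O.IsChannel)
    {lam : ℝ} (h0 : 0 ≤ lam) (h1 : lam ≤ 1) (f : Bits n → Bits n) (A : Algorithm n d) :
    A.prob lam f O true + A.prob lam f O false = 1 := by
  induction A with
  | output c => cases c <;> simp [Algorithm.prob]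
  | toss p next ih =>
    simp only [Algorithm.prob]
    rw [← (PMF.summable_toReal_mul p fun i => (next i).abs_prob_le_one hO h0 h1 f true).tsum_add
      (PMF.summable_toReal_mul p fun i => (next i).abs_prob_le_one hO h0 h1 f false)]
    simp only [← mul_add, ih, mul_one, PMF.tsum_toReal]
  | classical x next ih => exact ih _
  | circuit k L next ih =>
    simp only [Algorithm.prob]
    rw [← Finset.sum_add_distrib]
    simp only [← mul_add, ih, mul_one, sum_outputProb hO h0 h1 L]

/-- Hybrid argument over the tree: a circuit with c oracle uses shifts its output distribution by at
most cδ in total variation sum, and the subtrees below have N - c queries left. Classical queries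
cost nothing here, as both runs see the same `f`. -/
theorem Algorithm.abs_prob_sub_le {n d : ℕ} {O O' : Oracle n d} (hO : O.IsChannel)
    (hO' : O'.IsChannel) {lam δ : ℝ} (h0 : 0 ≤ lam) (h1 : lam ≤ 1) (hδ : 0 ≤ δ)
    (h : O.Close lam δ O') (f : Bits n → Bits n) (b : Bool) (A : Algorithm n d) :
    ∀ N : ℕ, A.QueriesAtMost N → |A.prob lam f O b - A.prob lam f O' b| ≤ N * δ := by
  induction A with
  | output c => intro N _; simp only [Algorithm.prob, sub_self, abs_zero]; positivity
  | toss p next ih =>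
    intro N hN
    simp only [Algorithm.prob]
    have s1 := PMF.summable_toReal_mul p fun i => (next i).abs_prob_le_one hO h0 h1 f b
    have s2 := PMF.summable_toReal_mul p fun i => (next i).abs_prob_le_one hO' h0 h1 f b
    rw [← s1.tsum_sub s2]
    simp only [← mul_sub]
    have hb : ∀ i, ‖(p i).toReal * ((next i).prob lam f O b - (next i).prob lam f O' b)‖ ≤
        (p i).toReal * (N * δ) := by
      intro i
      rw [Real.norm_eq_abs, abs_mul, abs_of_nonneg ENNReal.toReal_nonneg]
      exact mul_le_mul_of_nonneg_left (ih i N (hN i)) ENNReal.toReal_nonneg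
    have := tsum_of_norm_bounded
      ((PMF.summable_toReal p).hasSum.mul_right (N * δ)) hb
    rwa [PMF.tsum_toReal, one_mul, Real.norm_eq_abs] at this
  | classical x next ih =>
    intro N hN
    refine (ih (f x) (N - 1) (hN.2 _)).trans ?_
    gcongr
    omega
  | circuit k L next ih =>
    intro N hN
    simp only [Algorithm.prob]
    set c := (L.map Layer.cost).sum with hc
    have hsub : ((N - c : ℕ) : ℝ) = N - c := Nat.cast_sub hN.1
    have e1 : ∑ s, outputProb lam O L s * (next s).prob lam f O b -
        ∑ s, outputProb lam O' L s * (next s).prob lam f O' b =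
        ∑ s, outputProb lam O L s * ((next s).prob lam f O b - (next s).prob lam f O' b) +
        ∑ s, (outputProb lam O L s - outputProb lam O' L s) * (next s).prob lam f O' b := by
      rw [← Finset.sum_sub_distrib, ← Finset.sum_add_distrib]
      exact Finset.sum_congr rfl fun s _ => by ring
    rw [e1]
    have b1 : |∑ s, outputProb lam O L s *
        ((next s).prob lam f O b - (next s).prob lam f O' b)| ≤ (N - c) * δ := by
      refine (Finset.abs_sum_le_sum_abs _ _).trans ?_
      rw [← one_mul (((N : ℝ) - c) * δ), ← sum_outputProb hO h0 h1 L, Finset.sum_mul]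
      refine Finset.sum_le_sum fun s _ => ?_
      rw [abs_mul, abs_of_nonneg (outputProb_nonneg hO h0 h1 L s), ← hsub]
      exact mul_le_mul_of_nonneg_left (ih s _ (hN.2 s)) (outputProb_nonneg hO h0 h1 L s)
    have b2 : |∑ s, (outputProb lam O L s - outputProb lam O' L s) *
        (next s).prob lam f O' b| ≤ c * δ := by
      refine (Finset.abs_sum_le_sum_abs _ _).trans
        (le_trans (Finset.sum_le_sum fun s _ => ?_) (sum_abs_outputProb_sub_le hO hO' h0 h1 h L))
      rw [abs_mul]
      exact mul_le_of_le_one_right (abs_nonneg _) ((next s).abs_prob_le_one hO' h0 h1 f b)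
    refine (abs_add_le _ _).trans ((add_le_add b1 b2).trans (le_of_eq ?_))
    ring

/-! ### Concentration of the support of the last function -/

/-- The exponential moment of the values of a function on a random set, for a random permutation
whose law is invariant under swaps. -/
theorem sum_prod_one_add_le {Ω α : Type} [Fintype Ω] [Fintype α] [DecidableEq α]
    (c : Ω → Equiv.Perm α) (hc : ∀ τ : Equiv.Perm α, ∃ E : Ω ≃ Ω, ∀ ω, c (E ω) = c ω * τ)
    (g : α → ℝ) (hg : ∀ x, 0 ≤ g x) (X : Finset α) (hX : 2 * X.card ≤ Fintype.card α) :
    ∑ ω, ∏ x ∈ X, (1 + g (c ω x)) ≤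
      Fintype.card Ω * (1 + 2 * (∑ y, g y) / Fintype.card α) ^ X.card := by
  induction X using Finset.induction_on with
  | empty => simp
  | insert x₀ X hx₀ ih =>
    rw [Finset.card_insert_of_notMem hx₀] at hX
    have hX' : 2 * (X.card : ℝ) + 2 ≤ Fintype.card α := by
      have : ((2 * (X.card + 1) : ℕ) : ℝ) ≤ Fintype.card α := by exact_mod_cast hX
      push_cast at this; linarith
    set M : ℝ := ((Fintype.card α : ℕ) : ℝ) with hM
    have hXc : ((Xᶜ.card : ℕ) : ℝ) = M - X.card := by
      rw [Finset.card_compl, Nat.cast_sub (by omega)]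
    have hXpos : (0 : ℝ) ≤ X.card := Nat.cast_nonneg _
    have hpos : (0 : ℝ) < M - X.card := by linarith
    have hG : 0 ≤ ∑ y, g y := Finset.sum_nonneg fun y _ => hg y
    have hP : ∀ ω, 0 ≤ ∏ x ∈ X, (1 + g (c ω x)) := fun ω =>
      Finset.prod_nonneg fun x _ => by linarith [hg (c ω x)]
    -- By swap invariance `x₀` may be replaced by any point outside `X`. Averaging over these points
    -- makes the new factor an average of 1 + g over the values not yet used.
    have hswap : ∀ y ∈ Xᶜ, ∑ ω, ∏ x ∈ insert x₀ X, (1 + g (c ω x)) =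
        ∑ ω, (1 + g (c ω y)) * ∏ x ∈ X, (1 + g (c ω x)) := by
      intro y hy
      obtain ⟨E, hE⟩ := hc (Equiv.swap x₀ y)
      rw [← E.sum_comp]
      refine Finset.sum_congr rfl fun ω _ => ?_
      rw [Finset.prod_insert hx₀, hE, Equiv.Perm.mul_apply, Equiv.swap_apply_left]
      congr 1
      refine Finset.prod_congr rfl fun x hx => ?_
      rw [Equiv.Perm.mul_apply, Equiv.swap_apply_of_ne_of_ne]
      · rintro rfl; exact hx₀ hx
      · rintro rfl; exact (Finset.mem_compl.1 hy) hx
    have havg : (M - X.card) * ∑ ω, ∏ x ∈ insert x₀ X, (1 + g (c ω x)) ≤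
        (M - X.card + ∑ y, g y) * ∑ ω, ∏ x ∈ X, (1 + g (c ω x)) := by
      rw [← hXc, ← nsmul_eq_mul, ← Finset.sum_const, Finset.sum_congr rfl hswap, Finset.sum_comm,
        Finset.mul_sum]
      refine Finset.sum_le_sum fun ω _ => ?_
      rw [← Finset.sum_mul]
      refine mul_le_mul_of_nonneg_right ?_ (hP ω)
      rw [Finset.sum_add_distrib, Finset.sum_const, nsmul_eq_mul, mul_one, ← Equiv.sum_comp (c ω) g]
      exact add_le_add le_rfl
        (Finset.sum_le_univ_sum_of_nonneg (f := fun y => g (c ω y)) fun y => hg _)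
    -- At most half of the points are in `X`, which is the source of the factor 2.
    have hfac : (M - X.card + ∑ y, g y) ≤ (M - X.card) * (1 + 2 * (∑ y, g y) / M) := by
      have hMpos : 0 < M := by linarith
      have : ∑ y, g y ≤ (M - X.card) * (2 * (∑ y, g y) / M) := by
        rw [mul_div_assoc', le_div_iff₀ hMpos]
        nlinarith
      linarith
    have hS : 0 ≤ ∑ ω, ∏ x ∈ X, (1 + g (c ω x)) := Finset.sum_nonneg fun ω _ => hP ω
    have h1 : (M - X.card) * ∑ ω, ∏ x ∈ insert x₀ X, (1 + g (c ω x)) ≤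
        (M - X.card) * ((1 + 2 * (∑ y, g y) / M) * ∑ ω, ∏ x ∈ X, (1 + g (c ω x))) := by
      rw [← mul_assoc]
      exact havg.trans (mul_le_mul_of_nonneg_right hfac hS)
    refine (le_of_mul_le_mul_left h1 hpos).trans ?_
    rw [Finset.card_insert_of_notMem hx₀, pow_succ]
    calc _ ≤ (1 + 2 * (∑ y, g y) / M) *
          (Fintype.card Ω * (1 + 2 * (∑ y, g y) / M) ^ X.card) := by
          refine mul_le_mul_of_nonneg_left (ih (by omega)) ?_
          have : 0 < M := by linarith
          positivity
      _ = _ := by ring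

/-- The first function stands rightmost in the product, so changing it alone realizes right
multiplication of the chain. This needs at least one random permutation, hence the index d + 1. -/
theorem Shuffle.exists_chain_mul (n d : ℕ) (τ : Equiv.Perm (Bits ((d + 1 + 2) * n))) :
    ∃ E : Shuffle n (d + 1) ≃ Shuffle n (d + 1), ∀ σ,
      (E σ).chain = σ.chain * τ := by
  refine ⟨Equiv.mulRight (Pi.mulSingle 0 τ), fun σ => ?_⟩
  have : ∀ σ : Shuffle n (d + 1), σ.chain =
      (List.ofFn fun i : Fin d => σ i.succ).reverse.prod * σ 0 := by
    intro σ
    simp [Shuffle.chain, List.ofFn_succ]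
  rw [this, this]
  simp [mul_assoc, Pi.mulSingle_eq_of_ne]

/-- The exponential moment of the probability of reaching the support. -/
theorem expect_exp_flip_support_le {n d : ℕ} (hn : 1 ≤ n) {lam a θ : ℝ} (h0 : 0 ≤ lam)
    (h1 : lam ≤ 1) (ha : 0 < a)
    (ha1 : (1 - lam / 2) ^ ((d + 1 + 2) * n) ≤ a) (hθ : 0 ≤ θ)
    (hθa : 2 * Real.exp (θ * a) * 2 ^ n ≤ 2 * a * 2 ^ ((d + 1 + 2) * n))
    (z : Bits ((d + 1 + 2) * n)) :
    𝔼 σ : Shuffle n (d + 1),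
      Real.exp (θ * ∑ w ∈ σ.support, ∏ j, flip lam (z j) (w j)) ≤ Real.exp 2 := by
  classical
  set p : Bits ((d + 1 + 2) * n) → ℝ := fun w => ∏ j, flip lam (z j) (w j) with hp
  have hp0 : ∀ w, 0 ≤ p w := fun w => Finset.prod_nonneg fun j _ => flip_nonneg h0 h1 _ _
  have hpa : ∀ w, p w ≤ a := by
    intro w
    refine le_trans (Finset.prod_le_prod (fun j _ => flip_nonneg h0 h1 _ _)
      fun j _ => flip_le h1 _ _) ?_
    simpa using ha1
  have hp1 : ∑ w, p w = 1 := sum_prod_flip lam z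
  set g : Bits ((d + 1 + 2) * n) → ℝ := fun w => Real.exp (θ * p w) - 1 with hg
  have hg0 : ∀ w, 0 ≤ g w := fun w => by
    have := Real.add_one_le_exp (θ * p w)
    have := mul_nonneg hθ (hp0 w)
    simp only [hg]; linarith
  have hgle : ∀ w, g w ≤ p w * (Real.exp (θ * a) / a) := by
    intro w
    -- On [0, a] the function exp(θ·) lies below its chord, which bounds `g` linearly in `p`, whose
    -- total mass is 1.
    have hconv := convexOn_exp.2 (Set.mem_univ 0) (Set.mem_univ (θ * a))
      (sub_nonneg.2 ((div_le_one ha).2 (hpa w))) (div_nonneg (hp0 w) ha.le) (by ring)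
    simp only [smul_eq_mul, mul_zero, zero_add, Real.exp_zero, mul_one] at hconv
    have e : p w / a * (θ * a) = θ * p w := by field_simp
    rw [e] at hconv
    have e2 : p w * (Real.exp (θ * a) / a) = p w / a * Real.exp (θ * a) := by ring
    have := div_nonneg (hp0 w) ha.le
    simp only [hg]; rw [e2]; linarith
  have hgsum : ∑ w, g w ≤ Real.exp (θ * a) / a := by
    calc _ ≤ ∑ w, p w * (Real.exp (θ * a) / a) := Finset.sum_le_sum fun w _ => hgle w
      _ = _ := by rw [← Finset.sum_mul, hp1, one_mul]
  set X : Finset (Bits ((d + 1 + 2) * n)) := Finset.univ.image (embed n (d + 1)) with hX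
  have hXcard : X.card = 2 ^ n := by
    rw [hX, Finset.card_image_of_injective _ (embed_injective n (d + 1))]; simp
  have hsupp : ∀ σ : Shuffle n (d + 1), Real.exp (θ * ∑ w ∈ σ.support, p w) =
      ∏ x ∈ X, (1 + g (σ.chain x)) := by
    intro σ
    have : σ.support = X.image σ.chain := by
      rw [hX, Finset.image_image]; rfl
    rw [this, Finset.sum_image σ.chain.injective.injOn, Finset.mul_sum, Real.exp_sum]
    exact Finset.prod_congr rfl fun x _ => by simp [hg]
  have hcard : (Fintype.card (Bits ((d + 1 + 2) * n)) : ℝ) = 2 ^ ((d + 1 + 2) * n) := by simp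
  have hmain := sum_prod_one_add_le (fun σ : Shuffle n (d + 1) => σ.chain)
    (Shuffle.exists_chain_mul n d) g hg0 X (by
      rw [hXcard]
      simp only [Fintype.card_pi, Fintype.card_bool, Finset.prod_const, Finset.card_univ,
        Fintype.card_fin]
      rw [← pow_succ']
      exact Nat.pow_le_pow_right (by norm_num) (by nlinarith))
  rw [expect_real_eq, inv_mul_le_iff₀ (by positivity)]
  simp only [hsupp]
  refine hmain.trans (mul_le_mul_of_nonneg_left ?_ (by positivity))
  rw [hXcard, hcard]
  set M : ℝ := 2 ^ ((d + 1 + 2) * n) with hM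
  have hMpos : 0 < M := by positivity
  have hy : 2 * (∑ w, g w) / M ≤ 2 / 2 ^ n := by
    rw [div_le_div_iff₀ hMpos (by positivity)]
    have : ∑ w, g w ≤ M / 2 ^ n := hgsum.trans (by
      rw [div_le_div_iff₀ ha (by positivity)]; linarith)
    rw [le_div_iff₀ (by positivity)] at this
    linarith
  calc (1 + 2 * (∑ w, g w) / M) ^ 2 ^ n ≤ (Real.exp (2 / 2 ^ n)) ^ 2 ^ n := by
        have : 0 ≤ ∑ w, g w := Finset.sum_nonneg fun w _ => hg0 w
        refine pow_le_pow_left₀ (by positivity) ?_ _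
        have := Real.add_one_le_exp ((2 : ℝ) / 2 ^ n)
        linarith
    _ = Real.exp 2 := by
        rw [← Real.exp_nat_mul]; congr 1; push_cast; field_simp

/-- A bound for the probability that noise maps a string to the support, uniform in the string and
bounded on average over the shuffling. -/
theorem exists_flip_support_bound {n d : ℕ} (hn : 1 ≤ n) {lam a : ℝ} (h0 : 0 ≤ lam)
    (h1 : lam ≤ 1) (ha : (1 / 2 : ℝ) ^ n ≤ a)
    (ha1 : (1 - lam / 2) ^ ((d + 1 + 2) * n) ≤ a) :
    ∃ q : Shuffle n (d + 1) → ℝ, (∀ σ, 0 ≤ q σ) ∧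
      (∀ σ, ∀ z : Bits ((d + 1 + 2) * n), ∑ w ∈ σ.support, ∏ j, flip lam (z j) (w j) ≤ q σ) ∧ 𝔼 σ, q σ ≤ 19 * a := by
  classical
  have hapos : 0 < a := lt_of_lt_of_le (by positivity) ha
  have hl2 := Real.log_two_gt_d9
  have hl2' := Real.log_two_lt_d9
  set m := (d + 1 + 2) * n with hm
  set D : ℝ := (((d + 1) * n : ℕ) : ℝ) with hD
  have hD1 : 1 ≤ D := by
    rw [hD]; exact_mod_cast Nat.one_le_iff_ne_zero.2 (by positivity)
  -- Chosen so that exp(θa) = 2^((d+1)n): the largest power that still leaves a factor 2^n · 2^n in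
  -- 2^m, one for the size of the support and one to offset `a`.
  set θ : ℝ := D * Real.log 2 / a with hθ
  have hθpos : 0 < θ := by positivity
  have hθa : Real.exp (θ * a) = 2 ^ ((d + 1) * n) := by
    rw [hθ, div_mul_cancel₀ _ hapos.ne', hD, Real.exp_nat_mul, Real.exp_log (by norm_num)]
  set Z : Shuffle n (d + 1) → Bits m → ℝ := fun σ z =>
    Real.exp (θ * ∑ w ∈ σ.support, ∏ j, flip lam (z j) (w j)) with hZ
  have hZE : ∀ z, 𝔼 σ, Z σ z ≤ Real.exp 2 := by
    refine fun z => expect_exp_flip_support_le hn h0 h1 hapos ha1 hθpos.le ?_ z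
    rw [hθa]
    have e1 : (2 : ℝ) ^ m = 2 ^ ((d + 1) * n) * 2 ^ n * 2 ^ n := by
      rw [← pow_add, ← pow_add, hm]; congr 1; ring
    rw [e1]
    have e2 : 1 ≤ a * 2 ^ n := by
      have := mul_le_mul_of_nonneg_right ha (by positivity : (0 : ℝ) ≤ 2 ^ n)
      rwa [← mul_pow, show (1 / 2 : ℝ) * 2 = 1 by norm_num, one_pow] at this
    have e3 : (0 : ℝ) ≤ 2 ^ ((d + 1) * n) * 2 ^ n := by positivity
    nlinarith
  -- A soft maximum over `z`: the bound t ≤ exp t is applied to t = θy - m log 2, the shift paying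
  -- for the union over the 2^m strings. Its mean is at most (m log 2 + e^2)/θ; m ≤ 3D and e^2 ≤ 8
  -- then give the constant 19 with room to spare.
  refine ⟨fun σ => (m * Real.log 2 + (2 ^ m)⁻¹ * ∑ z, Z σ z) / θ, fun σ => ?_, fun σ z => ?_, ?_⟩
  · have : 0 ≤ ∑ z, Z σ z := Finset.sum_nonneg fun z _ => (Real.exp_pos _).le
    positivity
  · rw [le_div_iff₀ hθpos]
    set y := ∑ w ∈ σ.support, ∏ j, flip lam (z j) (w j) with hy
    have e1 : θ * y - m * Real.log 2 ≤ Real.exp (θ * y - m * Real.log 2) := by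
      linarith [Real.add_one_le_exp (θ * y - m * Real.log 2)]
    have e2 : Real.exp (θ * y - m * Real.log 2) = (2 ^ m)⁻¹ * Z σ z := by
      rw [Real.exp_sub, Real.exp_nat_mul, Real.exp_log (by norm_num)]; field_simp; rfl
    have e3 : Z σ z ≤ ∑ z, Z σ z :=
      Finset.single_le_sum (f := Z σ) (fun z _ => (Real.exp_pos _).le) (Finset.mem_univ z)
    have e4 : (2 ^ m : ℝ)⁻¹ * Z σ z ≤ (2 ^ m)⁻¹ * ∑ z, Z σ z :=
      mul_le_mul_of_nonneg_left e3 (by positivity)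
    linarith
  · have e1 : 𝔼 σ : Shuffle n (d + 1), (m * Real.log 2 + (2 ^ m)⁻¹ * ∑ z, Z σ z) / θ =
        (m * Real.log 2 + (2 ^ m)⁻¹ * ∑ z, 𝔼 σ, Z σ z) / θ := by
      rw [← Finset.expect_div, Finset.expect_add_distrib, Fintype.expect_const,
        ← Finset.mul_expect, Finset.expect_sum_comm]
    rw [e1, div_le_iff₀ hθpos]
    have e2 : (2 ^ m : ℝ)⁻¹ * ∑ z, 𝔼 σ, Z σ z ≤ Real.exp 2 := by
      rw [inv_mul_le_iff₀ (by positivity)]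
      refine (Finset.sum_le_sum fun z _ => hZE z).trans (le_of_eq ?_)
      simp
    have e3 : 19 * a * θ = 19 * (D * Real.log 2) := by rw [hθ]; field_simp
    have e4 : (m : ℝ) ≤ 3 * D := by
      rw [hD, hm]
      have : (d + 1 + 2) * n ≤ 3 * ((d + 1) * n) := by nlinarith
      exact_mod_cast this
    have e5 : Real.exp 2 ≤ 8 := by
      have := Real.exp_one_lt_d9
      have h2 : Real.exp 2 = Real.exp 1 * Real.exp 1 := by rw [← Real.exp_add]; norm_num
      have := Real.exp_pos 1
      rw [h2]; nlinarith
    rw [e3]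
    have e6 : (m : ℝ) * Real.log 2 ≤ 3 * D * Real.log 2 :=
      mul_le_mul_of_nonneg_right e4 (by linarith)
    have e7 : 1 * Real.log 2 ≤ D * Real.log 2 := mul_le_mul_of_nonneg_right hD1 (by linarith)
    nlinarith

/-! ### Classical queries -/

open scoped Classical in
/-- If a class of functions dominates another one on all cylinders of size at most `T`, then it does
so for the acceptance probability of every algorithm, provided the quantum oracle is independent of
the function. -/
theorem Algorithm.sum_prob_le_of_cylinders {n d : ℕ} {O : Oracle n d} (hO : O.IsChannel)
    {lam : ℝ} (h0 : 0 ≤ lam) (h1 : lam ≤ 1) (b : Bool) (C D : Finset (Bits n → Bits n))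
    (c c' : ℝ) (T : ℕ)
    (h : ∀ (X : Finset (Bits n)) (v : Bits n → Bits n), X.card ≤ T →
      c * (D.filter fun f => ∀ x ∈ X, f x = v x).card ≤
        c' * (C.filter fun f => ∀ x ∈ X, f x = v x).card) (A : Algorithm n d) :
    ∀ (N : ℕ) (X : Finset (Bits n)) (v : Bits n → Bits n), A.QueriesAtMost N → X.card + N ≤ T →
      c * ∑ f ∈ D with ∀ x ∈ X, f x = v x, A.prob lam f O b ≤
        c' * ∑ f ∈ C with ∀ x ∈ X, f x = v x, A.prob lam f O b := by
  induction A with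
  | output a =>
    intro N X v _ hX
    simp only [Algorithm.prob]
    split_ifs
    · simpa using h X v (by omega)
    · simp
  | toss p next ih =>
    intro N X v hN hX
    simp only [Algorithm.prob]
    have hs : ∀ f, Summable fun i => (p i).toReal * (next i).prob lam f O b := fun f =>
      PMF.summable_toReal_mul p fun i => (next i).abs_prob_le_one hO h0 h1 f b
    rw [← Summable.tsum_finsetSum fun f _ => hs f, ← Summable.tsum_finsetSum fun f _ => hs f,
      ← tsum_mul_left, ← tsum_mul_left]
    refine Summable.tsum_le_tsum (fun i => ?_) ((summable_sum fun f _ => hs f).mul_left c)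
      ((summable_sum fun f _ => hs f).mul_left c')
    rw [← Finset.mul_sum, ← Finset.mul_sum, mul_left_comm, mul_left_comm c']
    exact mul_le_mul_of_nonneg_left (ih i N X v (hN i) hX) ENNReal.toReal_nonneg
  | classical x next ih =>
    intro N X v hN hX
    have hN1 := hN.1
    simp only [Algorithm.prob]
    -- A repeated query has an answer fixed by the cylinder. A new one splits the cylinder according
    -- to the answer and adds one point to `X`.
    by_cases hx : x ∈ X
    · have e : ∀ C : Finset (Bits n → Bits n),
          ∑ f ∈ C with ∀ x ∈ X, f x = v x, (next (f x)).prob lam f O b =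
          ∑ f ∈ C with ∀ x ∈ X, f x = v x, (next (v x)).prob lam f O b := fun C =>
        Finset.sum_congr rfl fun f hf => by rw [(Finset.mem_filter.1 hf).2 x hx]
      rw [e, e]
      exact ih (v x) (N - 1) X v (hN.2 _) (by omega)
    · have e : ∀ C : Finset (Bits n → Bits n),
          ∑ f ∈ C with ∀ x ∈ X, f x = v x, (next (f x)).prob lam f O b =
          ∑ y, ∑ f ∈ C with ∀ z ∈ insert x X, f z = Function.update v x y z,
            (next y).prob lam f O b := by
        intro C
        rw [← Finset.sum_fiberwise _ fun f : Bits n → Bits n => f x]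
        refine Finset.sum_congr rfl fun y _ => ?_
        rw [Finset.filter_filter]
        refine Finset.sum_congr (Finset.filter_congr fun f _ => ?_) fun f hf => ?_
        · rw [Finset.forall_mem_insert, Function.update_self, and_comm]
          refine and_congr_right fun _ => forall₂_congr fun z hz => ?_
          rw [Function.update_of_ne]
          rintro rfl; exact hx hz
        · have := (Finset.mem_filter.1 hf).2 x (Finset.mem_insert_self x X)
          rw [Function.update_self] at this
          rw [this]
      rw [e, e, Finset.mul_sum, Finset.mul_sum]
      refine Finset.sum_le_sum fun y _ => ih y (N - 1) _ _ (hN.2 _) ?_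
      rw [Finset.card_insert_of_notMem hx]; omega
  | circuit k L next ih =>
    intro N X v hN hX
    have hN1 := hN.1
    simp only [Algorithm.prob]
    rw [Finset.sum_comm, Finset.sum_comm (s := C.filter _), Finset.mul_sum, Finset.mul_sum]
    refine Finset.sum_le_sum fun s _ => ?_
    rw [← Finset.mul_sum, ← Finset.mul_sum, mul_left_comm, mul_left_comm c']
    exact mul_le_mul_of_nonneg_left (ih s _ X v (hN.2 s) (by omega))
      (outputProb_nonneg hO h0 h1 L s)

section Cylinders

variable {α : Type} [Fintype α] [DecidableEq α]

/-- Extend `g` from `X` to a permutation and substitute it into π; the count is thus independent of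
`g`. -/
theorem card_perm_comp_eq (g v : α → α) (X : Finset α) (hg : Set.InjOn g X) :
    (Finset.univ.filter fun π : Equiv.Perm α => ∀ x ∈ X, π (g x) = v x).card =
      (Finset.univ.filter fun π : Equiv.Perm α => ∀ x ∈ X, π x = v x).card := by
  obtain ⟨τ, hτ⟩ := Finset.exists_equiv_extend_of_card_eq (t := (Finset.univ : Finset α))
    Finset.card_univ.symm (Finset.subset_univ (X.image g)) hg
  set τ' : Equiv.Perm α := τ.trans (Equiv.subtypeUnivEquiv Finset.mem_univ) with hτ'
  have hτX : ∀ x ∈ X, τ' x = g x := hτ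
  rw [Finset.card_filter, Finset.card_filter]
  refine Eq.trans (Finset.sum_congr rfl fun π _ => ?_)
    (Equiv.sum_comp (Equiv.mulRight τ')
      fun π : Equiv.Perm α => if ∀ x ∈ X, π x = v x then 1 else 0)
  have : (∀ x ∈ X, (Equiv.mulRight τ' π) x = v x) ↔ ∀ x ∈ X, π (g x) = v x := by
    refine forall₂_congr fun x hx => ?_
    rw [Equiv.coe_mulRight, Equiv.Perm.mul_apply, hτX x hx]
  simp only [this]

/-- Double counting: each π acts bijectively on `C`, so drawing from `C` amounts to drawing g from
`C` and then relabelling its values by a random permutation. -/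
theorem card_perm_mul_card_cylinder (C : Finset (α → α))
    (hC : ∀ f ∈ C, ∀ π : Equiv.Perm α, π ∘ f ∈ C) (X : Finset α) (v : α → α) :
    Fintype.card (Equiv.Perm α) * (C.filter fun f => ∀ x ∈ X, f x = v x).card =
      ∑ g ∈ C, (Finset.univ.filter fun π : Equiv.Perm α => ∀ x ∈ X, π (g x) = v x).card := by
  have h : ∀ π : Equiv.Perm α, (C.filter fun f => ∀ x ∈ X, f x = v x).card =
      (C.filter fun g => ∀ x ∈ X, π (g x) = v x).card := by
    intro π
    symm
    refine Finset.card_bij' (fun g _ => π ∘ g) (fun f _ => π.symm ∘ f) ?_ ?_ ?_ ?_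
    · intro g hg
      rw [Finset.mem_filter] at hg ⊢
      exact ⟨hC g hg.1 π, hg.2⟩
    · intro f hf
      rw [Finset.mem_filter] at hf ⊢
      exact ⟨hC f hf.1 π.symm, fun x hx => by simpa using hf.2 x hx⟩
    · intro g _; ext x; simp
    · intro f _; ext x; simp
  rw [← smul_eq_mul, ← Finset.card_univ, ← Finset.sum_const, Finset.sum_congr rfl fun π _ => h π]
  simp only [Finset.card_filter]
  rw [Finset.sum_comm]

/-- Union bound over the ordered pairs of distinct points of `X`. -/
theorem card_not_injOn_le (C : Finset (α → α)) {K : ℝ} (hK0 : 0 ≤ K)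
    (hK : ∀ x y, x ≠ y → ((C.filter fun f => f y = f x).card : ℝ) ≤ K) (X : Finset α) :
    ((C.filter fun f => ¬ ∀ x ∈ X, ∀ y ∈ X, f y = f x → x = y).card : ℝ) ≤ X.card ^ 2 * K := by
  have hsub : (C.filter fun f => ¬ ∀ x ∈ X, ∀ y ∈ X, f y = f x → x = y) ⊆
      X.offDiag.biUnion fun z => C.filter fun f => f z.2 = f z.1 := by
    intro f hf
    rw [Finset.mem_filter] at hf
    obtain ⟨hf, h⟩ := hf
    push Not at h
    obtain ⟨x, hx, y, hy, hxy, hne⟩ := h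
    exact Finset.mem_biUnion.2 ⟨(x, y), Finset.mem_offDiag.2 ⟨hx, hy, hne⟩,
      Finset.mem_filter.2 ⟨hf, hxy⟩⟩
  calc _ ≤ (((X.offDiag.biUnion fun z => C.filter fun f => f z.2 = f z.1).card : ℕ) : ℝ) := by
        exact_mod_cast Finset.card_le_card hsub
    _ ≤ ∑ z ∈ X.offDiag, ((C.filter fun f => f z.2 = f z.1).card : ℝ) := by
        exact_mod_cast Finset.card_biUnion_le
    _ ≤ ∑ z ∈ X.offDiag, K :=
        Finset.sum_le_sum fun z hz => hK z.1 z.2 (Finset.mem_offDiag.1 hz).2.2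
    _ ≤ X.card ^ 2 * K := by
        rw [Finset.sum_const, nsmul_eq_mul]
        refine mul_le_mul_of_nonneg_right ?_ hK0
        rw [Finset.offDiag_card, sq]
        exact_mod_cast Nat.sub_le _ _

/-- A class that is closed under postcomposition and has few collisions almost dominates the
injective functions on cylinders. -/
theorem cylinder_injective_le (C D : Finset (α → α))
    (hC : ∀ f ∈ C, ∀ π : Equiv.Perm α, π ∘ f ∈ C) (hD : ∀ f ∈ D, ∀ π : Equiv.Perm α, π ∘ f ∈ D)
    (hDinj : ∀ f ∈ D, Function.Injective f) (hCne : C.Nonempty) (hDne : D.Nonempty) {κ : ℝ}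
    (hκ0 : 0 ≤ κ)
    (hκ : ∀ x y, x ≠ y → ((C.filter fun f => f y = f x).card : ℝ) ≤ κ * C.card)
    (T : ℕ) (X : Finset α) (hX : X.card ≤ T) (v : α → α) :
    (1 - T ^ 2 * κ) * (D.card : ℝ)⁻¹ * (D.filter fun f => ∀ x ∈ X, f x = v x).card ≤
      (C.card : ℝ)⁻¹ * (C.filter fun f => ∀ x ∈ X, f x = v x).card := by
  set p : ℕ := (Finset.univ.filter fun π : Equiv.Perm α => ∀ x ∈ X, π x = v x).card with hp
  set M : ℕ := Fintype.card (Equiv.Perm α) with hM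
  have hMpos : (0 : ℝ) < M := by exact_mod_cast Fintype.card_pos
  have hCpos : (0 : ℝ) < C.card := by exact_mod_cast hCne.card_pos
  have hDpos : (0 : ℝ) < D.card := by exact_mod_cast hDne.card_pos
  have h1 : M * (D.filter fun f => ∀ x ∈ X, f x = v x).card = D.card * p := by
    rw [hM, card_perm_mul_card_cylinder D hD, ← smul_eq_mul, ← Finset.sum_const]
    exact Finset.sum_congr rfl fun g hg => card_perm_comp_eq g v X (hDinj g hg).injOn
  -- Functions without a collision on `X` contribute exactly as injective ones do; the others are
  -- discarded, which makes this one-sided.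
  have h2 : (C.filter fun f => ∀ x ∈ X, ∀ y ∈ X, f y = f x → x = y).card * p ≤
      M * (C.filter fun f => ∀ x ∈ X, f x = v x).card := by
    rw [hM, card_perm_mul_card_cylinder C hC, ← smul_eq_mul, ← Finset.sum_const]
    refine (Finset.sum_le_sum fun g hg => ?_).trans
      (Finset.sum_le_sum_of_subset (Finset.filter_subset _ _))
    exact (card_perm_comp_eq g v X fun x hx y hy hxy =>
      (Finset.mem_filter.1 hg).2 x hx y hy hxy.symm).ge
  have h3 := card_not_injOn_le C (K := κ * C.card) (by positivity) hκ X
  have h4 := Finset.card_filter_add_card_filter_not (s := C)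
    (fun f => ∀ x ∈ X, ∀ y ∈ X, f y = f x → x = y)
  have h4' : ((C.filter fun f => ∀ x ∈ X, ∀ y ∈ X, f y = f x → x = y).card : ℝ) +
      (C.filter fun f => ¬ ∀ x ∈ X, ∀ y ∈ X, f y = f x → x = y).card = C.card := by
    exact_mod_cast h4
  have hXT : (X.card : ℝ) ^ 2 ≤ T ^ 2 := by
    have : (X.card : ℝ) ≤ T := by exact_mod_cast hX
    gcongr
  have h5 : (1 - T ^ 2 * κ) * C.card ≤
      (C.filter fun f => ∀ x ∈ X, ∀ y ∈ X, f y = f x → x = y).card := by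
    have : (X.card : ℝ) ^ 2 * (κ * C.card) ≤ T ^ 2 * (κ * C.card) := by gcongr
    nlinarith
  have h1' : (M : ℝ) * (D.filter fun f => ∀ x ∈ X, f x = v x).card = D.card * p := by
    exact_mod_cast h1
  have h2' : ((C.filter fun f => ∀ x ∈ X, ∀ y ∈ X, f y = f x → x = y).card : ℝ) * p ≤
      M * (C.filter fun f => ∀ x ∈ X, f x = v x).card := by
    exact_mod_cast h2
  have hp0 : (0 : ℝ) ≤ p := Nat.cast_nonneg _
  rw [← mul_le_mul_iff_right₀ hMpos]
  calc (M : ℝ) * ((1 - T ^ 2 * κ) * (D.card : ℝ)⁻¹ * (D.filter fun f => ∀ x ∈ X, f x = v x).card)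
      = (1 - T ^ 2 * κ) * (D.card : ℝ)⁻¹ *
        (M * (D.filter fun f => ∀ x ∈ X, f x = v x).card) := by ring
    _ = (C.card : ℝ)⁻¹ * ((1 - T ^ 2 * κ) * C.card * p) := by rw [h1']; field_simp
    _ ≤ (C.card : ℝ)⁻¹ * (M * (C.filter fun f => ∀ x ∈ X, f x = v x).card) := by
        refine mul_le_mul_of_nonneg_left ?_ (by positivity)
        exact (mul_le_mul_of_nonneg_right h5 hp0).trans h2'
    _ = _ := by ring

/-- In a class of two-to-one functions that is closed under precomposition with a two-transitive
family, collisions are rare. -/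
theorem card_collision_mul_le (C : Finset (α → α))
    (hC : ∀ f ∈ C, ∀ x, (Finset.univ.filter fun y => f y = f x).card = 2)
    (hsymm : ∀ x y y' : α, y ≠ x → y' ≠ x → ∃ τ : Equiv.Perm α, τ x = x ∧ τ y = y' ∧
      ∀ f ∈ C, f ∘ τ ∈ C) (x y : α) (hxy : x ≠ y) :
    (Fintype.card α - 1) * (C.filter fun f => f y = f x).card = C.card := by
  have hle : ∀ y y', y ≠ x → y' ≠ x →
      (C.filter fun f => f y' = f x).card ≤ (C.filter fun f => f y = f x).card := by
    intro y y' hy hy'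
    obtain ⟨τ, hτx, hτy, hτ⟩ := hsymm x y y' hy hy'
    refine Finset.card_le_card_of_injOn (fun f => f ∘ τ) ?_ ?_
    · intro f hf
      rw [Finset.mem_coe, Finset.mem_filter] at hf ⊢
      exact ⟨hτ f hf.1, by simpa [hτx, hτy] using hf.2⟩
    · intro f _ g _ h
      exact τ.surjective.injective_comp_right h
  -- Each function gives `x` a unique partner, so the collision counts over all y ≠ x sum to the
  -- size of `C`; by `hle` they are all equal.
  have hone : ∀ f ∈ C, ((Finset.univ.erase x).filter fun y => f y = f x).card = 1 := by
    intro f hf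
    rw [Finset.filter_erase, Finset.card_erase_of_mem (by simp), hC f hf x]
  have hsum : ∑ y' ∈ Finset.univ.erase x, (C.filter fun f => f y' = f x).card = C.card := by
    simp only [Finset.card_filter]
    rw [Finset.sum_comm]
    simp only [← Finset.card_filter]
    rw [Finset.sum_congr rfl hone, Finset.sum_const, smul_eq_mul, mul_one]
  rw [← hsum, Finset.sum_congr rfl fun y' hy' => le_antisymm
    (hle y y' hxy.symm (Finset.ne_of_mem_erase hy'))
    (hle y' y (Finset.ne_of_mem_erase hy') hxy.symm), Finset.sum_const, smul_eq_mul,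
    Finset.card_erase_of_mem (Finset.mem_univ x), Finset.card_univ]

end Cylinders

/-! ### Symmetries of the two promises -/

theorem Promise.Holds.card_fiber {n : ℕ} {P : Promise} {f : Bits n → Bits n} (h : P.Holds f)
    (x : Bits n) : (Finset.univ.filter fun y => f y = f x).card = 2 := by
  cases P with
  | arbitrary => exact h x
  | mask =>
    obtain ⟨s, hs, h⟩ := h
    have : (Finset.univ.filter fun y => f y = f x) = {x, fun i => xor (x i) (s i)} := by
      ext y
      simp only [Finset.mem_filter, Finset.mem_univ, true_and, Finset.mem_insert,
        Finset.mem_singleton]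
      rw [eq_comm, h x y]
    rw [this, Finset.card_pair]
    intro hx
    refine hs (funext fun i => ?_)
    have := congrFun hx i
    revert this
    cases x i <;> cases s i <;> simp

theorem Promise.Holds.comp_left {n : ℕ} {P : Promise} {f : Bits n → Bits n} (h : P.Holds f)
    {π : Bits n → Bits n} (hπ : Function.Injective π) : P.Holds (π ∘ f) := by
  cases P with
  | arbitrary => intro x; simpa [hπ.eq_iff] using h x
  | mask =>
    obtain ⟨s, hs, h⟩ := h
    exact ⟨s, hs, fun x y => by rw [Function.comp_apply, Function.comp_apply, hπ.eq_iff, h]⟩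

/-- A linear involution that maps one nonzero bit string to another one. -/
theorem exists_linear_involution {n : ℕ} (u u' : Bits n) (hu : u ≠ fun _ => false)
    (hu' : u' ≠ fun _ => false) :
    ∃ T : Bits n → Bits n, Function.Involutive T ∧ T u = u' ∧
      ∀ v w, T (fun i => xor (v i) (w i)) = fun i => xor (T v i) (T w i) := by
  -- A linear functional equal to 1 at both `u` and `u'`: a single coordinate, or the sum of two.
  obtain ⟨φ, hφ, hφu, hφu'⟩ : ∃ φ : Bits n → Bool,
      (∀ v w, φ (fun i => xor (v i) (w i)) = xor (φ v) (φ w)) ∧ φ u = true ∧ φ u' = true := by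
    obtain ⟨i, hi⟩ := Function.ne_iff.1 hu
    obtain ⟨j, hj⟩ := Function.ne_iff.1 hu'
    replace hi : u i = true := by simpa using hi
    replace hj : u' j = true := by simpa using hj
    by_cases h1 : u' i = true
    · exact ⟨fun v => v i, fun _ _ => rfl, hi, h1⟩
    by_cases h2 : u j = true
    · exact ⟨fun v => v j, fun _ _ => rfl, h2, hj⟩
    · refine ⟨fun v => xor (v i) (v j), fun v w => ?_, ?_, ?_⟩
      · dsimp only
        cases v i <;> cases v j <;> cases w i <;> cases w j <;> rfl
      · simp [hi, h2]
      · simp [hj, h1]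
  have hself : φ (fun i => xor (u i) (u' i)) = false := by rw [hφ, hφu, hφu']; rfl
  -- The transvection v + φ(v)(u + u'); it is an involution because φ(u + u') = 0.
  refine ⟨fun v i => xor (v i) (φ v && xor (u i) (u' i)), fun v => ?_, ?_, fun v w => ?_⟩
  · cases hv : φ v
    · simp [hv]
    · have h : φ (fun i => xor (v i) (xor (u i) (u' i))) = true := by
        rw [hφ v fun i => xor (u i) (u' i), hself, hv]; rfl
      ext i
      simp only [hv, Bool.true_and, h]
      cases v i <;> cases u i <;> cases u' i <;> rfl
  · ext i
    simp only [hφu]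
    cases u i <;> cases u' i <;> rfl
  · ext i
    simp only [hφ]
    cases φ v <;> cases φ w <;> cases v i <;> cases w i <;> cases u i <;> cases u' i <;> rfl

/-- Any transposition preserves general two-to-one functions. For masks the symmetry must be affine:
conjugating a linear involution `T` by translation by `x` fixes `x`, and precomposition turns the
mask s into T s. -/
theorem Promise.exists_symmetry {n : ℕ} (P : Promise) (x y y' : Bits n) (hy : y ≠ x)
    (hy' : y' ≠ x) : ∃ τ : Equiv.Perm (Bits n), τ x = x ∧ τ y = y' ∧
      ∀ f, P.Holds f → P.Holds (f ∘ τ) := by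
  cases P with
  | arbitrary =>
    refine ⟨Equiv.swap y y', Equiv.swap_apply_of_ne_of_ne hy.symm hy'.symm,
      Equiv.swap_apply_left y y', fun f hf z => ?_⟩
    rw [← hf (Equiv.swap y y' z), Finset.card_filter, Finset.card_filter]
    exact Equiv.sum_comp (Equiv.swap y y') fun w => if f w = f (Equiv.swap y y' z) then 1 else 0
  | mask =>
    have hne : ∀ z : Bits n, z ≠ x → (fun i => xor (x i) (z i)) ≠ fun _ => false := by
      intro z hz h
      refine hz (funext fun i => ?_)
      have := congrFun h i
      revert this
      cases x i <;> cases z i <;> simp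
    obtain ⟨T, hT, hTu, hTadd⟩ := exists_linear_involution _ _ (hne y hy) (hne y' hy')
    have hxx : ∀ a z : Bits n, (fun i => xor (a i) (xor (a i) (z i))) = z := by
      intro a z; ext i; simp
    have hT0 : T (fun _ => false) = fun _ => false := by
      have := hTadd (fun _ => false) fun _ => false
      simpa using this
    set F : Bits n → Bits n := fun z i => xor (x i) (T (fun j => xor (x j) (z j)) i) with hF
    have hinv : Function.Involutive F := by
      intro z
      simp only [hF, hxx]
      rw [hT, hxx]
    refine ⟨hinv.toPerm F, ?_, ?_, fun f hf => ?_⟩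
    · simp [hF, hT0]
    · simp only [Function.Involutive.coe_toPerm, hF, hTu, hxx]
    · obtain ⟨s, hs, h⟩ := hf
      refine ⟨T s, fun h0 => hs ?_, fun z w => ?_⟩
      · rw [← hT s, h0, hT0]
      · have hshift : (fun i => xor (F z i) (s i)) = F fun i => xor (z i) (T s i) := by
          have hTT : ∀ s, T (T s) = s := hT
          simp only [hF, hTadd, hTT]
          ext i
          cases x i <;> cases T x i <;> cases T z i <;> cases s i <;> rfl
        rw [Function.comp_apply, Function.comp_apply, h, Function.Involutive.coe_toPerm,
          hinv.injective.eq_iff, hshift, hinv.injective.eq_iff]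

/-! ### The lower bound -/

-- The partner of a point is equidistributed over the 2^n - 1 other points, so this is the cylinder
-- comparison with κ = 1/(2^n - 1), started from the empty cylinder.
open scoped Classical in
theorem Algorithm.expect_injective_le {n d : ℕ} (hn : 1 ≤ n) {O : Oracle n d} (hO : O.IsChannel)
    {lam : ℝ} (h0 : 0 ≤ lam) (h1 : lam ≤ 1) (b : Bool) (P : Promise) (A : Algorithm n d) (N : ℕ)
    (hA : A.QueriesAtMost N)
    (hP : (Finset.univ.filter fun f : Bits n → Bits n => P.Holds f).Nonempty) :
    (1 - N ^ 2 * (2 ^ n - 1 : ℝ)⁻¹) *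
      (𝔼 f ∈ Finset.univ.filter (fun f : Bits n → Bits n => Function.Injective f),
        A.prob lam f O b) ≤
      𝔼 f ∈ Finset.univ.filter (fun f : Bits n → Bits n => P.Holds f), A.prob lam f O b := by
  set C := Finset.univ.filter fun f : Bits n → Bits n => P.Holds f with hC
  set D := Finset.univ.filter fun f : Bits n → Bits n => Function.Injective f with hD
  have hpow : (2 : ℝ) ≤ 2 ^ n := by
    simpa using pow_le_pow_right₀ (by norm_num : (1 : ℝ) ≤ 2) hn
  have hcol : ∀ x y : Bits n, x ≠ y →
      ((C.filter fun f => f y = f x).card : ℝ) ≤ (2 ^ n - 1 : ℝ)⁻¹ * C.card := by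
    intro x y hxy
    have h := card_collision_mul_le C (fun f hf => (Finset.mem_filter.1 hf).2.card_fiber)
      (fun x y y' hy hy' => by
        obtain ⟨τ, h1, h2, h3⟩ := P.exists_symmetry x y y' hy hy'
        exact ⟨τ, h1, h2, fun f hf => Finset.mem_filter.2
          ⟨Finset.mem_univ _, h3 f (Finset.mem_filter.1 hf).2⟩⟩) x y hxy
    rw [le_inv_mul_iff₀ (by linarith)]
    have hcard : ((Fintype.card (Bits n) - 1 : ℕ) : ℝ) = 2 ^ n - 1 := by
      rw [Nat.cast_sub Fintype.card_pos]; simp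
    rw [← hcard]
    exact_mod_cast h.le
  have hcyl := cylinder_injective_le C D
    (fun f hf π => Finset.mem_filter.2
      ⟨Finset.mem_univ _, (Finset.mem_filter.1 hf).2.comp_left π.injective⟩)
    (fun f hf π => Finset.mem_filter.2
      ⟨Finset.mem_univ _, π.injective.comp (Finset.mem_filter.1 hf).2⟩)
    (fun f hf => (Finset.mem_filter.1 hf).2) hP
    ⟨id, Finset.mem_filter.2 ⟨Finset.mem_univ _, Function.injective_id⟩⟩
    (inv_nonneg.2 (by linarith)) hcol N
  have := A.sum_prob_le_of_cylinders hO h0 h1 b C D _ _ N (fun X v hX => by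
    convert hcyl X hX v) N ∅ id hA (by simp)
  simp only [Finset.notMem_empty, IsEmpty.forall_iff, implies_true, Finset.filter_true] at this
  rw [Finset.expect_eq_sum_div_card, Finset.expect_eq_sum_div_card, div_eq_inv_mul,
    div_eq_inv_mul, ← mul_assoc]
  exact this

/-! ### The two sampling conventions and the final estimates. -/

/-- The oracle of an algorithm, if the shuffling that is sampled at the start is `σ`. -/
noncomputable def Access.oracle {n d : ℕ} (acc : Access) (σ : Shuffle n d) (f : Bits n → Bits n) :
    Oracle n d :=
  match acc with
  | .sampledOnce => fixedOracle σ f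
  | .fresh => mixedOracle n d f

theorem Access.oracle_isChannel {n d : ℕ} (acc : Access) (σ : Shuffle n d) (f : Bits n → Bits n) :
    (acc.oracle σ f).IsChannel := by
  cases acc with
  | sampledOnce => exact fixedOracle_isChannel σ f
  | fresh => exact mixedOracle_isChannel f

theorem Algorithm.probOn_eq_expect {n d : ℕ} (A : Algorithm n d) (lam : ℝ) (acc : Access)
    (f : Bits n → Bits n) (b : Bool) :
    A.probOn lam acc f b = 𝔼 σ : Shuffle n d, A.prob lam f (acc.oracle σ f) b := by
  cases acc with
  | sampledOnce => rfl
  | fresh => simp [Algorithm.probOn, Access.oracle]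

theorem mixedOracle_close {n d : ℕ} {lam : ℝ} {f g : Bits n → Bits n} {δ : Shuffle n d → ℝ}
    (h : ∀ σ, (fixedOracle σ f).Close lam (δ σ) (fixedOracle σ g)) :
    (mixedOracle n d f).Close lam (𝔼 σ, δ σ) (mixedOracle n d g) := by
  intro k e ρ hρ hρ1
  rw [mixedOracle, mixedOracle, ← Finset.expect_sub_distrib]
  exact traceSmall_expect fun σ => h σ k e ρ hρ hρ1

/-- For fresh sampling, convexity of the trace norm bounds the error of the averaged channel by the
average of the errors. Only the mean of the error bound matters later, so both conventions give the
same result. -/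
theorem Access.exists_oracle_close {n d : ℕ} (acc : Access) {lam : ℝ} {δ : Shuffle n d → ℝ}
    (hδ0 : ∀ σ, 0 ≤ δ σ)
    (h : ∀ σ f, (fixedOracle σ f).Close lam (δ σ) (fixedOracle σ fun _ _ => false)) :
    ∃ δ' : Shuffle n d → ℝ, (∀ σ, 0 ≤ δ' σ) ∧ 𝔼 σ, δ' σ = 𝔼 σ, δ σ ∧
      ∀ σ f, (acc.oracle σ f).Close lam (δ' σ) (acc.oracle σ fun _ _ => false) := by
  cases acc with
  | sampledOnce => exact ⟨δ, hδ0, rfl, h⟩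
  | fresh =>
    exact ⟨fun _ => 𝔼 σ, δ σ, fun _ => Finset.expect_nonneg fun σ _ => hδ0 σ, by simp,
      fun _ f => mixedOracle_close fun σ => h σ f⟩

/-- The comparison is with the run `ref` whose oracle is built from the zero function. There the two
output probabilities sum to one, so the dominance of two-to-one over injective functions for output
`false` caps the advantage. -/
theorem Algorithm.successProb_le {n d : ℕ} {lam : ℝ} (h0 : 0 ≤ lam) (h1 : lam ≤ 1) (P : Promise)
    (acc : Access) (A : Algorithm n d) (N : ℕ) (hA : A.QueriesAtMost N) {δ : Shuffle n d → ℝ}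
    (hδ0 : ∀ σ, 0 ≤ δ σ)
    (hδ : ∀ σ f, (fixedOracle σ f).Close lam (δ σ) (fixedOracle σ fun _ _ => false)) :
    A.successProb lam P acc ≤ 1 / 2 + N * (𝔼 σ, δ σ) + N ^ 2 * (2 ^ n - 1 : ℝ)⁻¹ := by
  classical
  unfold Algorithm.successProb
  set C := Finset.univ.filter fun f : Bits n → Bits n => P.Holds f with hC
  set D := Finset.univ.filter fun f : Bits n → Bits n => Function.Injective f with hD
  obtain ⟨δ', hδ'0, hδ'E, hclose⟩ := acc.exists_oracle_close hδ0 hδ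
  set ref : Bool → (Bits n → Bits n) → ℝ := fun b f =>
    𝔼 σ : Shuffle n d, A.prob lam f (acc.oracle σ fun _ _ => false) b with href
  have hDne : D.Nonempty := ⟨id, Finset.mem_filter.2 ⟨Finset.mem_univ _, Function.injective_id⟩⟩
  have hch := fun σ : Shuffle n d => acc.oracle_isChannel σ fun _ _ => false
  have hpow : (1 : ℝ) ≤ 2 ^ n := one_le_pow₀ (by norm_num)
  have hη : 0 ≤ N * (𝔼 σ, δ σ) :=
    mul_nonneg (Nat.cast_nonneg _) (Finset.expect_nonneg fun σ _ => hδ0 σ)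
  have hβ : 0 ≤ N ^ 2 * (2 ^ n - 1 : ℝ)⁻¹ :=
    mul_nonneg (by positivity) (inv_nonneg.2 (by linarith))
  have hon : ∀ f b, A.probOn lam acc f b ≤ ref b f + N * (𝔼 σ, δ σ) := by
    intro f b
    rw [A.probOn_eq_expect, href, ← hδ'E, Finset.mul_expect, ← Finset.expect_add_distrib]
    refine Finset.expect_le_expect fun σ _ => ?_
    have := (abs_le.1 (A.abs_prob_sub_le (acc.oracle_isChannel σ f) (hch σ) h0 h1 (hδ'0 σ)
      (hclose σ f) f b N hA)).2
    linarith
  have hadd : ∀ f, ref true f = 1 - ref false f := by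
    intro f
    rw [eq_sub_iff_add_eq, href, ← Finset.expect_add_distrib]
    simp only [A.prob_true_add_prob_false (hch _) h0 h1 f]
    simp
  have hle1 : ∀ b f, ref b f ≤ 1 := by
    intro b f
    refine (Finset.expect_le_expect fun σ _ =>
      (A.prob_nonneg_and_le_one (hch σ) h0 h1 f b).2).trans ?_
    simp
  have hDon : 𝔼 f ∈ D, A.probOn lam acc f false ≤ 𝔼 f ∈ D, ref false f + N * (𝔼 σ, δ σ) := by
    rw [← Finset.expect_const hDne (N * (𝔼 σ, δ σ)), ← Finset.expect_add_distrib]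
    exact Finset.expect_le_expect fun f _ => hon f false
  have hD1 : 𝔼 f ∈ D, ref false f ≤ 1 := by
    rw [← Finset.expect_const hDne (1 : ℝ)]
    exact Finset.expect_le_expect fun f _ => hle1 false f
  -- An expectation over the empty class is 0, so then the success probability is at most 1/2 plus
  -- the error.
  rcases C.eq_empty_or_nonempty with hCe | hCne
  · rw [hCe, Finset.expect_empty]
    linarith
  have hCon : 𝔼 f ∈ C, A.probOn lam acc f true ≤ 1 - 𝔼 f ∈ C, ref false f + N * (𝔼 σ, δ σ) := by
    rw [← Finset.expect_const hCne (N * (𝔼 σ, δ σ)), ← Finset.expect_const hCne (1 : ℝ),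
      ← Finset.expect_sub_distrib, ← Finset.expect_add_distrib]
    exact Finset.expect_le_expect fun f _ => by rw [← hadd]; exact hon f true
  have hn : 1 ≤ n := by
    by_contra hn
    obtain rfl : n = 0 := by omega
    obtain ⟨f, hf⟩ := hCne
    have := (Finset.mem_filter.1 hf).2.card_fiber default
    have h2 := Finset.card_le_univ (Finset.univ.filter fun y => f y = f default)
    rw [this] at h2
    simp at h2
  have hcls : (1 - N ^ 2 * (2 ^ n - 1 : ℝ)⁻¹) * (𝔼 f ∈ D, ref false f) ≤ 𝔼 f ∈ C, ref false f := by
    rw [href]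
    simp only
    rw [Finset.expect_comm, Finset.expect_comm (s := C), Finset.mul_expect]
    exact Finset.expect_le_expect fun σ _ =>
      A.expect_injective_le hn (hch σ) h0 h1 false P N hA hCne
  have : N ^ 2 * (2 ^ n - 1 : ℝ)⁻¹ * (𝔼 f ∈ D, ref false f) ≤ N ^ 2 * (2 ^ n - 1 : ℝ)⁻¹ :=
    mul_le_of_le_one_right hβ hD1
  linarith

/-- With N = 0 both error terms vanish, so any valid closeness bound will do; q = r = 1 always
works. -/
theorem Algorithm.one_le_of_successProb {n d : ℕ} {lam : ℝ} (h0 : 0 ≤ lam) (h1 : lam ≤ 1)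
    (P : Promise) (acc : Access) (A : Algorithm n d) (N : ℕ) (hA : A.QueriesAtMost N)
    (h : 1 / 2 < A.successProb lam P acc) : 1 ≤ N := by
  by_contra hN
  obtain rfl : N = 0 := by omega
  have := A.successProb_le h0 h1 P acc 0 hA (δ := fun _ => 2 * (1 / 1 + 1)) (fun _ => by norm_num)
    fun σ f k e ρ hρ hρ1 => fixedOracle_sub_traceSmall σ f h0 h1 one_pos zero_le_one
      (fun z => (Finset.sum_le_univ_sum_of_nonneg fun w =>
        Finset.prod_nonneg fun j _ => flip_nonneg h0 h1 _ _).trans (sum_prod_flip lam z).le)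
      k e hρ hρ1
  simp at this
  linarith

/-- The parameters are a = E^(-2) and r = E^(-1), which balances q/r against r and makes the mean
error per query at most 2(19 + 1)/E. -/
theorem Algorithm.successProb_le_exp {n d : ℕ} (hn : 1 ≤ n) {lam : ℝ} (h0 : 0 ≤ lam)
    (h1 : lam ≤ 1) (P : Promise) (acc : Access) (A : Algorithm n (d + 1)) (N : ℕ)
    (hA : A.QueriesAtMost N) {E : ℝ}
    (hE : E = Real.exp (1 / 4 * ((n : ℝ) * min (1 / 2) (lam * ((d + 1 : ℕ) : ℝ))))) :
    A.successProb lam P acc ≤ 1 / 2 + 40 * (N / E) + 2 * (N / E) ^ 2 := by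
  set μ : ℝ := (n : ℝ) * min (1 / 2) (lam * ((d + 1 : ℕ) : ℝ)) with hμ
  have hEpos : 0 < E := hE ▸ Real.exp_pos _
  have hn' : (1 : ℝ) ≤ n := by exact_mod_cast hn
  have hμ1 : μ ≤ n * (1 / 2) := by rw [hμ]; gcongr; exact min_le_left _ _
  have hμ2 : μ ≤ n * (lam * ((d + 1 : ℕ) : ℝ)) := by rw [hμ]; gcongr; exact min_le_right _ _
  have hl2 := Real.log_two_gt_d9
  have hr : E⁻¹ * E⁻¹ = Real.exp (-(μ / 2)) := by
    rw [hE, ← Real.exp_neg, ← Real.exp_add]; congr 1; ring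
  have ha : (1 / 2 : ℝ) ^ n ≤ E⁻¹ * E⁻¹ := by
    rw [hr, show (1 / 2 : ℝ) = Real.exp (-Real.log 2) by
      rw [Real.exp_neg, Real.exp_log (by norm_num), one_div], ← Real.exp_nat_mul, Real.exp_le_exp]
    nlinarith
  have ha1 : (1 - lam / 2) ^ ((d + 1 + 2) * n) ≤ E⁻¹ * E⁻¹ := by
    rw [hr]
    calc (1 - lam / 2) ^ ((d + 1 + 2) * n) ≤ Real.exp (-(lam / 2)) ^ ((d + 1 + 2) * n) := by
          refine pow_le_pow_left₀ (by linarith) ?_ _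
          linarith [Real.add_one_le_exp (-(lam / 2))]
      _ ≤ Real.exp (-(μ / 2)) := by
          rw [← Real.exp_nat_mul, Real.exp_le_exp]
          push_cast at hμ2 ⊢
          have : 0 ≤ lam * n := by positivity
          nlinarith
  obtain ⟨q, hq0, hq, hqE⟩ := exists_flip_support_bound hn h0 h1 ha ha1
  have hrpos : 0 < E⁻¹ := inv_pos.2 hEpos
  have hmain := A.successProb_le h0 h1 P acc N hA (δ := fun σ => 2 * (q σ / E⁻¹ + E⁻¹))
    (fun σ => by have := hq0 σ; positivity) fun σ f k e ρ hρ hρ1 =>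
      fixedOracle_sub_traceSmall σ f h0 h1 hrpos (hq0 σ) (hq σ) k e hρ hρ1
  have hδ : 𝔼 σ : Shuffle n (d + 1), 2 * (q σ / E⁻¹ + E⁻¹) ≤ 40 * E⁻¹ := by
    rw [← Finset.mul_expect, Finset.expect_add_distrib, Fintype.expect_const, ← Finset.expect_div]
    have : (𝔼 σ, q σ) / E⁻¹ ≤ 19 * E⁻¹ := by
      rw [div_le_iff₀ hrpos]; linarith
    linarith
  have hβ : (2 ^ n - 1 : ℝ)⁻¹ ≤ 2 * (E⁻¹ * E⁻¹) := by
    have hpow : (2 : ℝ) ≤ 2 ^ n := by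
      simpa using pow_le_pow_right₀ (by norm_num : (1 : ℝ) ≤ 2) hn
    have e1 : (2 ^ n - 1 : ℝ)⁻¹ ≤ 2 * (1 / 2) ^ n := by
      rw [inv_le_iff_one_le_mul₀ (by linarith), one_div, inv_pow]
      field_simp
      linarith
    linarith
  have hN : (0 : ℝ) ≤ N := Nat.cast_nonneg _
  calc _ ≤ _ := hmain
    _ ≤ 1 / 2 + N * (40 * E⁻¹) + N ^ 2 * (2 * (E⁻¹ * E⁻¹)) := by gcongr
    _ = _ := by rw [div_eq_mul_inv]; ring

end NISQ

theorem mainTheorem7 :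
    ∃ c : ℝ, 0 < c ∧ ∀ ε : ℝ, 0 < ε → ∃ K : ℝ, 0 < K ∧
      ∀ (n d : ℕ) (lam : ℝ) (P : NISQ.Promise) (acc : NISQ.Access)
        (A : NISQ.Algorithm n d) (N : ℕ),
        0 ≤ lam → lam ≤ 1 →
        A.QueriesAtMost N →
        1 / 2 + ε ≤ A.successProb lam P acc →
        K * Real.exp (c * ((n : ℝ) * min (1 / 2) (lam * (d : ℝ)))) ≤ (N : ℝ) := by
  -- If t = N/E is below 1, then 40t + 2t^2 ≤ 42t, so t < ε/43 would force an advantage below ε. The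
  -- 1 in the minimum also serves the cases with zero exponent.
  refine ⟨1 / 4, by norm_num, fun ε hε => ⟨min 1 (ε / 43), by positivity, ?_⟩⟩
  intro n d lam P acc A N h0 h1 hA hsucc
  have hN : (1 : ℝ) ≤ N := by
    exact_mod_cast A.one_le_of_successProb h0 h1 P acc N hA (by linarith)
  have htriv : (n : ℝ) * min (1 / 2) (lam * (d : ℝ)) = 0 →
      min 1 (ε / 43) * Real.exp (1 / 4 * ((n : ℝ) * min (1 / 2) (lam * (d : ℝ)))) ≤ (N : ℝ) := by
    intro h
    rw [h, mul_zero, Real.exp_zero, mul_one]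
    exact (min_le_left _ _).trans hN
  rcases Nat.eq_zero_or_pos n with hn | hn
  · exact htriv (by simp [hn])
  cases d with
  | zero => exact htriv (by simp)
  | succ d =>
    have h := A.successProb_le_exp hn h0 h1 P acc N hA rfl
    set E := Real.exp (1 / 4 * ((n : ℝ) * min (1 / 2) (lam * ((d + 1 : ℕ) : ℝ))))
    have hE : 0 < E := Real.exp_pos _
    rw [← le_div_iff₀ hE]
    have ht : 0 ≤ N / E := by positivity
    by_contra! hlt
    have h2 : N / E < 1 := hlt.trans_le (min_le_left _ _)
    have h3 : N / E < ε / 43 := hlt.trans_le (min_le_right _ _)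
    nlinarith
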